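/- Define $f,g,h:\mathbb{R}\to\mathbb{R}$ to be the $2\pi$-periodic functions with \[ f(x)=\tfrac{1}{128}\bigl(150\sin x+25\sin 3x+3\sin 5x\bigr), \] and, for $x\in(-\pi,\pi]$, $g(x)=0$ and $h(x)=\sqrt{1-f(x)^2}$ if $x\in[-\frac{\pi}{2},\frac{\pi}{2}]$, while $g(x)=\sqrt{1-f(x)^2}$ and $h(x)=0$ otherwise. For a $2\pi$-periodic function $q$ and a unitary matrix $V=Q\,\mathrm{diag}(e^{i\theta_1},\dots,e^{i\theta_d})\,Q^*$ with $Q$ unitary, let $q[V]=Q\,\mathrm{diag}(q(\theta_1),\dots,q(\theta_d))\,Q^*$. For unitary $U,V\in\mathbf{M}_d(\mathbb{C})$ let \[ B(U,V)=\begin{pmatrix} f[V] & g[V]+\frac12\{h[V],U\}\\ g[V]+\frac12\{h[V],U^*\} & -f[V]\end{pmatrix},\qquad \{X,Y\}=XY+YX, \] a hermitian $2d\times 2d$ matrix, and let the Bott index be $\kappa(U,V)=\frac12\mathrm{Sig}(B(U,V))$, where $\mathrm{Sig}$ is the number of positive eigenvalues minus the number of negative eigenvalues, counted with multiplicity. Let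 $[U,V]=UV-VU$ and let $\|\cdot\|$ be the operator norm. **Proposition.** Let $d$ be a natural number and let $U,V,U_1,V_1\in\mathbf{M}_d(\mathbb{C})$ be unitary with $\|[U,V]\|\le 0.206007$ and $\|[U_1,V_1]\|\le 0.206007$. If $\kappa(U_1,V_1)\ne\kappa(U,V)$, then \[ \|U-U_1\|+\|V-V_1\|\ \ge\ \tfrac15\sqrt{1-5\|[U,V]\|^2}+\tfrac15\sqrt{1-5\|[U_1,V_1]\|^2}. \] -/

import Mathlib

open scoped Matrix.Norms.L2Operator

noncomputable section

namespace Bott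

/-- The trigonometric polynomial `f`. -/
def f (x : ℝ) : ℝ :=
  (150 * Real.sin x + 25 * Real.sin (3 * x) + 3 * Real.sin (5 * x)) / 128

/-- The `2π`-periodic function `g`: modulo `2π`, the condition `0 ≤ cos x` says
`x ∈ [-π/2, π/2]`. -/
def g (x : ℝ) : ℝ := if 0 ≤ Real.cos x then 0 else Real.sqrt (1 - f x ^ 2)

/-- The `2π`-periodic function `h`: modulo `2π`, the condition `0 ≤ cos x` says
`x ∈ [-π/2, π/2]`. -/
def h (x : ℝ) : ℝ := if 0 ≤ Real.cos x then Real.sqrt (1 - f x ^ 2) else 0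

/-- The functional calculus `q[V]` of a unitary matrix `V` for a `2π`-periodic function `q` of the
angle: the eigenvalue `e^{iθ}` of `V` is replaced by `q θ`
(see `Bott.angleCalc_conj_diagonal`). -/
def angleCalc {d : ℕ} (q : ℝ → ℝ) (V : Matrix (Fin d) (Fin d) ℂ) : Matrix (Fin d) (Fin d) ℂ :=
  cfc (fun z : ℂ => ((q z.arg : ℝ) : ℂ)) V

/-- The matrix `B(U, V)`, in which `½{X, Y} = ½(XY + YX)`. -/
def B {d : ℕ} (U V : Matrix (Fin d) (Fin d) ℂ) : Matrix (Fin d ⊕ Fin d) (Fin d ⊕ Fin d) ℂ :=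
  Matrix.fromBlocks
    (angleCalc f V)
    (angleCalc g V + (1 / 2 : ℂ) • (angleCalc h V * U + U * angleCalc h V))
    (angleCalc g V + (1 / 2 : ℂ) • (angleCalc h V * star U + star U * angleCalc h V))
    (-angleCalc f V)

theorem angleCalc_conj_diagonal {d : ℕ} {q : ℝ → ℝ} (hq : Function.Periodic q (2 * Real.pi))
    (Q : Matrix.unitaryGroup (Fin d) ℂ) (θ : Fin d → ℝ) :
    angleCalc q ((Q : Matrix (Fin d) (Fin d) ℂ) *
        Matrix.diagonal (fun j => Complex.exp (θ j * Complex.I)) * star (Q : Matrix _ _ ℂ)) =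
      (Q : Matrix (Fin d) (Fin d) ℂ) * Matrix.diagonal (fun j => ((q (θ j) : ℝ) : ℂ)) *
        star (Q : Matrix _ _ ℂ) := by
  obtain ⟨w, hw⟩ : ∃ w : Fin d → ℂ, w = fun j => Complex.exp (θ j * Complex.I) := ⟨_, rfl⟩
  have hqw : ∀ j, q (w j).arg = q (θ j) := by
    intro j
    have h1 : (w j).arg = toIocMod Real.two_pi_pos (-Real.pi) (θ j) := by
      rw [hw]
      exact Complex.arg_exp_mul_I _
    have h2 := self_sub_toIocDiv_zsmul Real.two_pi_pos (-Real.pi) (θ j)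
    rw [h1, ← h2]
    exact hq.sub_zsmul_eq _
  rw [← hw]
  obtain ⟨p, hp⟩ : ∃ p : Polynomial ℂ, ∀ j, p.eval (w j) = ((q (θ j) : ℝ) : ℂ) := by
    obtain ⟨r, hr⟩ : ∃ r : ℂ → ℂ, r = fun z => ((q z.arg : ℝ) : ℂ) := ⟨_, rfl⟩
    refine ⟨Lagrange.interpolate (Finset.univ.image w) id r, fun j => ?_⟩
    have h3 := Lagrange.eval_interpolate_at_node (s := Finset.univ.image w) (v := id) r
      (Set.injOn_id _) (Finset.mem_image_of_mem w (Finset.mem_univ j))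
    rw [id] at h3
    rw [h3, hr, ← hqw j]
  let φ : (Fin d → ℂ) →⋆ₐ[ℂ] Matrix (Fin d) (Fin d) ℂ :=
    { Matrix.diagonalAlgHom ℂ with
      map_star' := fun v => by
        exact (Matrix.diagonal_conjTranspose v).symm }
  let ψ : (Fin d → ℂ) →⋆ₐ[ℂ] Matrix (Fin d) (Fin d) ℂ :=
    ((Unitary.conjStarAlgAut ℂ _ Q : Matrix (Fin d) (Fin d) ℂ ≃⋆ₐ[ℂ] _) :
      Matrix (Fin d) (Fin d) ℂ →⋆ₐ[ℂ] _).comp φ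
  have hψ : ∀ v, ψ v = (Q : Matrix (Fin d) (Fin d) ℂ) * Matrix.diagonal v *
      star (Q : Matrix _ _ ℂ) := fun v => rfl
  rw [← hψ w, ← hψ]
  have hn : IsStarNormal (ψ w) := by
    refine ⟨?_⟩
    rw [← map_star]
    exact (Commute.all (star w) w).map ψ
  unfold angleCalc
  have hc : cfc (fun z : ℂ => ((q z.arg : ℝ) : ℂ)) (ψ w) = cfc (fun z => p.eval z) (ψ w) := by
    refine cfc_congr fun z hz => ?_
    rw [hψ, Unitary.spectrum_star_right_conjugate, spectrum_diagonal] at hz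
    obtain ⟨j, rfl⟩ := hz
    simp only [hp, hqw]
  rw [hc, cfc_polynomial p (ψ w)]
  have hm : Polynomial.aeval (ψ w) p = ψ (Polynomial.aeval w p) :=
    Polynomial.aeval_algHom_apply ψ.toAlgHom w p
  rw [hm]
  congr 1
  funext j
  have := Polynomial.aeval_algHom_apply (Pi.evalAlgHom ℂ (fun _ : Fin d => ℂ) j) w p
  simp only [Pi.evalAlgHom_apply, Polynomial.coe_aeval_eq_eval] at this
  rw [← this, hp]

theorem star_angleCalc {d : ℕ} (q : ℝ → ℝ) (V : Matrix (Fin d) (Fin d) ℂ) :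
    star (angleCalc q V) = angleCalc q V := by
  unfold angleCalc
  rw [← cfc_star]
  congr 1
  funext z
  simp

theorem isHermitian_B {d : ℕ} (U V : Matrix (Fin d) (Fin d) ℂ) : (B U V).IsHermitian := by
  have hs := fun q => star_angleCalc (d := d) q V
  simp only [Matrix.star_eq_conjTranspose] at hs
  unfold B
  rw [Matrix.isHermitian_fromBlocks_iff]
  simp only [Matrix.IsHermitian, Matrix.conjTranspose_add, Matrix.conjTranspose_smul,
    Matrix.conjTranspose_mul, Matrix.star_eq_conjTranspose, Matrix.conjTranspose_conjTranspose, hs,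
    Matrix.conjTranspose_neg, true_and, and_true]
  simp [add_comm]

/-- The signature of a hermitian matrix: the number of positive eigenvalues minus the number of
negative eigenvalues, counted with multiplicity. -/
def Sig {ι : Type*} [Fintype ι] [DecidableEq ι] {A : Matrix ι ι ℂ} (hA : A.IsHermitian) : ℤ :=
  (Nat.card {i // 0 < hA.eigenvalues i} : ℤ) - (Nat.card {i // hA.eigenvalues i < 0} : ℤ)

/-- The Bott index `κ(U, V) = ½ Sig(B(U, V))`. It is written as a rational number, so that no
rounding is involved; it is an integer whenever `B(U, V)` is invertible. -/
def kappa {d : ℕ} (U V : Matrix (Fin d) (Fin d) ℂ) : ℚ := (Sig (isHermitian_B U V) : ℚ) / 2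

end Bott

end

/-!
Write `F = f[V]`, `G = g[V]`, `H = h[V]`, let `σ_x`, `σ_z` be the Pauli matrices, and let
`W = [[0, U], [U*, 0]]`. Then `B` is the hermitian part of `T = F σ_z + G σ_x + H W`, where `F`, `G`,
`H` stand for `diag(F, F)` and so on. The proof combines a lower bound for the spectral gap of `B`
around `0` with a Lipschitz estimate for `B`: by a count of dimensions, hermitian matrices with
different signatures and with gaps `γ`, `γ'` have distance at least `γ + γ'`
(`add_le_norm_sub_of_sig_ne`).

*Gap* (`gapBound_mul_sq_norm_le`). By the parallelogram law,
`‖B v‖² = (‖T v‖² + ‖T* v‖²) / 2 - ‖[H, W] v‖² / 4`, and `T* T` has the same lower bound as `T T*`.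
From `F² + G² + H² = 1` it follows that `T T*` differs from `1` by the off-diagonal block
`F U H - H U F = [F, U] H - [H, U] F` and the diagonal blocks `G U H + H U* G` (and the same with
`U*`). The first one is a row of commutators times the column `(H, -F)` of norm at most one
(`norm_f_mul_mul_h_sub_le`). The second one is at most half the norm of `[U, H - G]`, because `G` and
`H` are orthogonal positive contractions (`norm_mul_mul_add_le`).

*Lipschitz estimate* (`norm_B_sub_le`). `B` moves at most as much as `T`. As a function of `V`, the
sines in `f` come with `σ_z`, and the cosines in `g` and `h` come with `W + σ_x` or `W - σ_x`,
according to the parity of the harmonic.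

Since `g` and `h` are only needed up to a uniform error, both estimates are made for trigonometric
polynomials of degree `5` within `1 / 250` of them (`abs_h_sub_hPoly_le`, `abs_g_sub_gPoly_le`). Each
sum over harmonics is bounded by a weighted operator Cauchy–Schwarz inequality
(`norm_sum_harmonics_le`), which is much better than the triangle inequality: the sine and
cosine parts of one harmonic form a row of norm `k`, not `√2 k`, and distinct harmonics
multiply columns that are not parallel. The resulting constants are `γ² ≥ gapBound δ` and the Lipschitz
constant `163 / 50`, and `sqrt_add_le_sqrt_gapBound` compares them on `0 ≤ δ ≤ 0.206007`.
-/

namespace Bott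

/-! ### The functional calculus of a unitary matrix -/

section AngleCalc

variable {d : ℕ} {V : Matrix (Fin d) (Fin d) ℂ}

theorem continuousOn_spectrum (q : ℂ → ℂ) (V : Matrix (Fin d) (Fin d) ℂ) :
    ContinuousOn q (spectrum ℂ V) :=
  (Matrix.finite_spectrum V).continuousOn q

theorem angleCalc_add (p q : ℝ → ℝ) (V : Matrix (Fin d) (Fin d) ℂ) :
    angleCalc (fun x => p x + q x) V = angleCalc p V + angleCalc q V := by
  unfold angleCalc
  rw [← cfc_add _ _ _ (continuousOn_spectrum _ V) (continuousOn_spectrum _ V)]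
  simp

theorem angleCalc_sub (p q : ℝ → ℝ) (V : Matrix (Fin d) (Fin d) ℂ) :
    angleCalc (fun x => p x - q x) V = angleCalc p V - angleCalc q V := by
  unfold angleCalc
  rw [← cfc_sub _ _ _ (continuousOn_spectrum _ V) (continuousOn_spectrum _ V)]
  simp

theorem angleCalc_mul (p q : ℝ → ℝ) (V : Matrix (Fin d) (Fin d) ℂ) :
    angleCalc (fun x => p x * q x) V = angleCalc p V * angleCalc q V := by
  unfold angleCalc
  rw [← cfc_mul _ _ _ (continuousOn_spectrum _ V) (continuousOn_spectrum _ V)]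
  simp

theorem angleCalc_const_mul (c : ℝ) (q : ℝ → ℝ) (V : Matrix (Fin d) (Fin d) ℂ) :
    angleCalc (fun x => c * q x) V = (c : ℂ) • angleCalc q V := by
  unfold angleCalc
  rw [← cfc_const_mul _ _ _ (continuousOn_spectrum _ V)]
  simp

theorem isStarNormal_of_mem_unitaryGroup (hV : V ∈ Matrix.unitaryGroup (Fin d) ℂ) :
    IsStarNormal V :=
  ⟨by rw [Commute, SemiconjBy, Unitary.star_mul_self_of_mem hV, Unitary.mul_star_self_of_mem hV]⟩

theorem angleCalc_const (c : ℝ) (hV : V ∈ Matrix.unitaryGroup (Fin d) ℂ) :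
    angleCalc (fun _ => c) V = (c : ℂ) • 1 := by
  have := isStarNormal_of_mem_unitaryGroup hV
  unfold angleCalc
  rw [cfc_const (R := ℂ) _ V, Algebra.algebraMap_eq_smul_one]

theorem commute_angleCalc (p q : ℝ → ℝ) (V : Matrix (Fin d) (Fin d) ℂ) :
    angleCalc p V * angleCalc q V = angleCalc q V * angleCalc p V := by
  rw [← angleCalc_mul, ← angleCalc_mul]
  simp only [mul_comm]

theorem norm_angleCalc_le {q : ℝ → ℝ} {c : ℝ} (hq : ∀ x, |q x| ≤ c)
    (V : Matrix (Fin d) (Fin d) ℂ) : ‖angleCalc q V‖ ≤ c := by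
  have hc : 0 ≤ c := (abs_nonneg _).trans (hq 0)
  unfold angleCalc
  refine norm_cfc_le hc fun z _ => ?_
  rw [Complex.norm_real]
  exact hq _

theorem eq_exp_arg_of_mem_spectrum (hV : V ∈ Matrix.unitaryGroup (Fin d) ℂ) {z : ℂ}
    (hz : z ∈ spectrum ℂ V) : z = Complex.exp (z.arg * Complex.I) := by
  have h1 : ‖z‖ = 1 := spectrum.norm_eq_one_of_unitary hV hz
  have h2 := Complex.norm_mul_exp_arg_mul_I z
  rw [h1] at h2
  simpa using h2.symm

theorem cfc_pow_add_const_mul_star_pow (hV : V ∈ Matrix.unitaryGroup (Fin d) ℂ) (k : ℕ)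
    (c : ℂ) : cfc (fun z : ℂ => z ^ k + c * (star z) ^ k) V = V ^ k + c • star V ^ k := by
  have := isStarNormal_of_mem_unitaryGroup hV
  rw [cfc_add _ _ _ (continuousOn_spectrum _ V) (continuousOn_spectrum _ V),
    cfc_pow_id (R := ℂ) V k, cfc_const_mul _ _ _ (continuousOn_spectrum _ V),
    cfc_pow _ _ _ (continuousOn_spectrum _ V), cfc_star_id (R := ℂ) V]

/-- `cos k θ` in the functional calculus of a unitary matrix, written with its powers. -/
noncomputable def cosMat {ι : Type*} [Fintype ι] [DecidableEq ι] (k : ℕ) (V : Matrix ι ι ℂ) :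
    Matrix ι ι ℂ :=
  (1 / 2 : ℂ) • (V ^ k + star V ^ k)

/-- `sin k θ` in the functional calculus of a unitary matrix, written with its powers. -/
noncomputable def sinMat {ι : Type*} [Fintype ι] [DecidableEq ι] (k : ℕ) (V : Matrix ι ι ℂ) :
    Matrix ι ι ℂ :=
  (-Complex.I / 2 : ℂ) • (V ^ k - star V ^ k)

theorem angleCalc_cos (hV : V ∈ Matrix.unitaryGroup (Fin d) ℂ) (k : ℕ) :
    angleCalc (fun x => Real.cos (k * x)) V = cosMat k V := by
  have key : cosMat k V = cfc (fun z : ℂ => (1 / 2 : ℂ) * (z ^ k + 1 * (star z) ^ k)) V := by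
    rw [cfc_const_mul _ _ _ (continuousOn_spectrum _ V), cfc_pow_add_const_mul_star_pow hV,
      one_smul]
    rfl
  rw [key]
  unfold angleCalc
  refine cfc_congr fun z hz => ?_
  have h2 : z ^ k = Complex.exp (k * z.arg * Complex.I) := by
    conv_lhs => rw [eq_exp_arg_of_mem_spectrum hV hz]
    rw [← Complex.exp_nat_mul]; ring_nf
  have h3 : star z ^ k = Complex.exp (-(k * z.arg * Complex.I)) := by
    rw [← star_pow, h2, Complex.star_def, ← Complex.exp_conj]
    simp
  simp only [h2, h3]
  rw [Complex.ofReal_cos, Complex.cos]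
  push_cast
  ring_nf

theorem angleCalc_sin (hV : V ∈ Matrix.unitaryGroup (Fin d) ℂ) (k : ℕ) :
    angleCalc (fun x => Real.sin (k * x)) V = sinMat k V := by
  have key : sinMat k V =
      cfc (fun z : ℂ => (-Complex.I / 2 : ℂ) * (z ^ k + (-1) * (star z) ^ k)) V := by
    rw [cfc_const_mul _ _ _ (continuousOn_spectrum _ V), cfc_pow_add_const_mul_star_pow hV,
      neg_one_smul, ← sub_eq_add_neg]
    rfl
  rw [key]
  unfold angleCalc
  refine cfc_congr fun z hz => ?_
  have h2 : z ^ k = Complex.exp (k * z.arg * Complex.I) := by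
    conv_lhs => rw [eq_exp_arg_of_mem_spectrum hV hz]
    rw [← Complex.exp_nat_mul]; ring_nf
  have h3 : star z ^ k = Complex.exp (-(k * z.arg * Complex.I)) := by
    rw [← star_pow, h2, Complex.star_def, ← Complex.exp_conj]
    simp
  simp only [h2, h3]
  rw [Complex.ofReal_sin, Complex.sin]
  push_cast
  ring_nf

end AngleCalc

/-! ### Commutator estimates and the operator Cauchy–Schwarz inequality -/

section CauchySchwarz

variable {m ι : Type*} [Fintype m] [DecidableEq m] [Fintype ι] [DecidableEq ι]

theorem norm_le_one_of_mem_unitaryGroup {U : Matrix m m ℂ} (hU : U ∈ Matrix.unitaryGroup m ℂ) :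
    ‖U‖ ≤ 1 := by
  have h := CStarRing.norm_star_mul_self (x := U)
  rw [Unitary.star_mul_self_of_mem hU] at h
  have h1 : ‖(1 : Matrix m m ℂ)‖ ≤ 1 := by
    rw [Matrix.cstar_norm_def, map_one]
    exact ContinuousLinearMap.norm_id_le
  nlinarith [norm_nonneg U]

theorem norm_pow_mul_sub_mul_pow_le {V V' X : Matrix m m ℂ}
    (hV : ‖V‖ ≤ 1) (hV' : ‖V'‖ ≤ 1) (k : ℕ) :
    ‖V ^ k * X - X * V' ^ k‖ ≤ k * ‖V * X - X * V'‖ := by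
  have h1 : ‖(1 : Matrix m m ℂ)‖ ≤ 1 :=
    norm_le_one_of_mem_unitaryGroup (one_mem (Matrix.unitaryGroup m ℂ))
  have hpow : ∀ j : ℕ, ‖V ^ j‖ ≤ 1 := by
    intro j
    induction j with
    | zero => simpa using h1
    | succ j ih =>
      rw [pow_succ]
      exact (norm_mul_le _ _).trans (mul_le_one₀ ih (norm_nonneg _) hV)
  induction k with
  | zero => simp
  | succ k ih =>
    have e : V ^ (k + 1) * X - X * V' ^ (k + 1) =
        V ^ k * (V * X - X * V') + (V ^ k * X - X * V' ^ k) * V' := by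
      rw [pow_succ, pow_succ]; noncomm_ring
    have h2 : ‖V ^ k * (V * X - X * V')‖ ≤ 1 * ‖V * X - X * V'‖ :=
      (norm_mul_le _ _).trans (mul_le_mul_of_nonneg_right (hpow k) (norm_nonneg _))
    have h3 : ‖(V ^ k * X - X * V' ^ k) * V'‖ ≤ (k * ‖V * X - X * V'‖) * 1 :=
      (norm_mul_le _ _).trans (mul_le_mul ih hV' (norm_nonneg _) (by positivity))
    rw [e]
    refine (norm_add_le _ _).trans ?_
    push_cast
    linarith

theorem norm_star_mul_sub_mul_star_le {V V' X : Matrix m m ℂ}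
    (hV : V ∈ Matrix.unitaryGroup m ℂ) (hV' : V' ∈ Matrix.unitaryGroup m ℂ) :
    ‖star V * X - X * star V'‖ ≤ ‖V * X - X * V'‖ := by
  have e : star V * X - X * star V' = -(star V * (V * X - X * V') * star V') := by
    have h1 := Unitary.star_mul_self_of_mem hV
    have h2 := Unitary.mul_star_self_of_mem hV'
    have e2 : star V * (V * X - X * V') * star V' =
        (star V * V) * X * star V' - star V * X * (V' * star V') := by noncomm_ring
    rw [e2, h1, h2]; simp
  rw [e, norm_neg]
  have hs : ‖star V‖ ≤ 1 := by rw [norm_star]; exact norm_le_one_of_mem_unitaryGroup hV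
  have hs' : ‖star V'‖ ≤ 1 := by rw [norm_star]; exact norm_le_one_of_mem_unitaryGroup hV'
  calc ‖star V * (V * X - X * V') * star V'‖ ≤ ‖star V‖ * ‖V * X - X * V'‖ * ‖star V'‖ :=
        (norm_mul_le _ _).trans (mul_le_mul_of_nonneg_right (norm_mul_le _ _) (norm_nonneg _))
    _ ≤ 1 * ‖V * X - X * V'‖ * 1 := by gcongr
    _ = _ := by ring

theorem norm_cosMat_mul_sub_mul_cosMat_le {V V' X : Matrix m m ℂ}
    (hV : V ∈ Matrix.unitaryGroup m ℂ) (hV' : V' ∈ Matrix.unitaryGroup m ℂ) (k : ℕ) :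
    ‖cosMat k V * X - X * cosMat k V'‖ ≤ k * ‖V * X - X * V'‖ := by
  have e : cosMat k V * X - X * cosMat k V' = (1 / 2 : ℂ) •
      ((V ^ k * X - X * V' ^ k) + (star V ^ k * X - X * star V' ^ k)) := by
    simp only [cosMat, smul_mul_assoc, mul_smul_comm, ← smul_sub, add_mul, mul_add]
    congr 1; abel
  have h1 := norm_pow_mul_sub_mul_pow_le (X := X) (norm_le_one_of_mem_unitaryGroup hV)
    (norm_le_one_of_mem_unitaryGroup hV') k
  have h2 := norm_pow_mul_sub_mul_pow_le (X := X)
    (norm_le_one_of_mem_unitaryGroup (Unitary.star_mem hV))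
    (norm_le_one_of_mem_unitaryGroup (Unitary.star_mem hV')) k
  have h3 := mul_le_mul_of_nonneg_left (norm_star_mul_sub_mul_star_le (X := X) hV hV')
    (Nat.cast_nonneg (α := ℝ) k)
  rw [e, norm_smul]
  have h4 := norm_add_le (V ^ k * X - X * V' ^ k) (star V ^ k * X - X * star V' ^ k)
  have : ‖(1 / 2 : ℂ)‖ = 1 / 2 := by norm_num
  rw [this]
  linarith

/-- The row `(sin kV · X - X · sin kV', cos kV · X - X · cos kV')` has norm at most
`k ‖V X - X V'‖`: the change from `e^{±ikθ}` to `sin kθ, cos kθ` is `√2⁻¹` times a unitary one. -/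
theorem norm_sin_row_add_cos_row_le {V V' X : Matrix m m ℂ}
    (hV : V ∈ Matrix.unitaryGroup m ℂ) (hV' : V' ∈ Matrix.unitaryGroup m ℂ) (k : ℕ) :
    ‖(sinMat k V * X - X * sinMat k V') * star (sinMat k V * X - X * sinMat k V') +
      (cosMat k V * X - X * cosMat k V') * star (cosMat k V * X - X * cosMat k V')‖ ≤
      (k * ‖V * X - X * V'‖) ^ 2 := by
  obtain ⟨E, hE⟩ : ∃ E, E = V ^ k * X - X * V' ^ k := ⟨_, rfl⟩
  obtain ⟨D, hD⟩ : ∃ D, D = star V ^ k * X - X * star V' ^ k := ⟨_, rfl⟩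
  have e1 : cosMat k V * X - X * cosMat k V' = (1 / 2 : ℂ) • (E + D) := by
    simp only [hE, hD, cosMat, smul_mul_assoc, mul_smul_comm, ← smul_sub, add_mul, mul_add]
    congr 1; abel
  have e2 : sinMat k V * X - X * sinMat k V' = (-Complex.I / 2 : ℂ) • (E - D) := by
    simp only [hE, hD, sinMat, smul_mul_assoc, mul_smul_comm, ← smul_sub, sub_mul, mul_sub]
    congr 1; abel
  have h1 : ‖E‖ ≤ k * ‖V * X - X * V'‖ := by
    rw [hE]
    exact norm_pow_mul_sub_mul_pow_le (norm_le_one_of_mem_unitaryGroup hV)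
      (norm_le_one_of_mem_unitaryGroup hV') k
  have h2 : ‖D‖ ≤ k * ‖V * X - X * V'‖ := by
    rw [hD]
    refine (norm_pow_mul_sub_mul_pow_le
      (norm_le_one_of_mem_unitaryGroup (Unitary.star_mem hV))
      (norm_le_one_of_mem_unitaryGroup (Unitary.star_mem hV')) k).trans ?_
    exact mul_le_mul_of_nonneg_left (norm_star_mul_sub_mul_star_le hV hV') (Nat.cast_nonneg k)
  have e3 : (sinMat k V * X - X * sinMat k V') * star (sinMat k V * X - X * sinMat k V') +
      (cosMat k V * X - X * cosMat k V') * star (cosMat k V * X - X * cosMat k V') =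
      (1 / 2 : ℂ) • (E * star E + D * star D) := by
    rw [e1, e2, star_smul, star_smul, star_add, star_sub, smul_mul_smul_comm, smul_mul_smul_comm]
    have c1 : -Complex.I / 2 * star (-Complex.I / 2) = 1 / 4 := by
      apply Complex.ext <;> norm_num [Complex.star_def, Complex.div_re, Complex.div_im]
    have c2 : (1 / 2 : ℂ) * star (1 / 2 : ℂ) = 1 / 4 := by
      apply Complex.ext <;> norm_num [Complex.star_def, Complex.div_re, Complex.div_im]
    rw [c1, c2, ← smul_add]
    have e4 : (E - D) * (star E - star D) + (E + D) * (star E + star D) =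
        (2 : ℂ) • (E * star E + D * star D) := by
      rw [two_smul]; noncomm_ring
    rw [e4, smul_smul]
    norm_num
  rw [e3, norm_smul]
  have h4 := norm_add_le (E * star E) (D * star D)
  rw [CStarRing.norm_self_mul_star, CStarRing.norm_self_mul_star] at h4
  have : ‖(1 / 2 : ℂ)‖ = 1 / 2 := by norm_num
  rw [this]
  have h5 := mul_self_le_mul_self (norm_nonneg _) h1
  have h6 := mul_self_le_mul_self (norm_nonneg _) h2
  nlinarith

/-- The Cauchy–Schwarz inequality for operators: a row times a column. -/
theorem sq_norm_sum_mul_le (A C : ι → Matrix m m ℂ) :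
    ‖∑ i, A i * C i‖ ^ 2 ≤ ‖∑ i, A i * star (A i)‖ * ‖∑ i, star (C i) * C i‖ := by
  -- The row and the column as rectangular matrices.
  let R : Matrix m (ι × m) ℂ := Matrix.of fun x p => A p.1 x p.2
  let K : Matrix (ι × m) m ℂ := Matrix.of fun p y => C p.1 p.2 y
  have h1 : R * K = ∑ i, A i * C i := by
    ext x y
    simp [R, K, Matrix.mul_apply, Matrix.sum_apply, Fintype.sum_prod_type]
  have h2 : R * R.conjTranspose = ∑ i, A i * star (A i) := by
    ext x y
    simp [R, Matrix.mul_apply, Matrix.sum_apply, Fintype.sum_prod_type]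
  have h3 : K.conjTranspose * K = ∑ i, star (C i) * C i := by
    ext x y
    simp [K, Matrix.mul_apply, Matrix.sum_apply, Fintype.sum_prod_type]
  have h4 : ‖R‖ * ‖R‖ = ‖∑ i, A i * star (A i)‖ := by
    rw [← h2, ← Matrix.l2_opNorm_conjTranspose R, ← Matrix.l2_opNorm_conjTranspose_mul_self,
      Matrix.conjTranspose_conjTranspose]
  have h5 : ‖K‖ * ‖K‖ = ‖∑ i, star (C i) * C i‖ := by
    rw [← h3, Matrix.l2_opNorm_conjTranspose_mul_self]
  rw [← h1, ← h4, ← h5]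
  have h6 := Matrix.l2_opNorm_mul R K
  calc ‖R * K‖ ^ 2 ≤ (‖R‖ * ‖K‖) ^ 2 := by gcongr
    _ = _ := by ring

/-- A weighted operator Cauchy–Schwarz inequality for a trigonometric polynomial whose harmonic
`k i` contributes `S i * P i + C i * Q i`, where the row `(S i, C i)` has norm at most `k i * η`.
The weights `w` balance the harmonics. -/
theorem norm_sum_harmonics_le (k w : ι → ℝ) (S C P Q : ι → Matrix m m ℂ) {η M : ℝ}
    (hw : ∀ i, 0 < w i) (hk : ∀ i, 0 < k i) (hη : 0 ≤ η) (hM : 0 ≤ M)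
    (hrow : ∀ i, ‖S i * star (S i) + C i * star (C i)‖ ≤ (k i * η) ^ 2)
    (hsum : ∑ i, w i ≤ M)
    (hcol : ‖∑ i, ((k i ^ 2 / w i : ℝ) : ℂ) • (star (P i) * P i + star (Q i) * Q i)‖ ≤ M) :
    ‖∑ i, (S i * P i + C i * Q i)‖ ≤ M * η := by
  -- The scaling of the row by `√w / k` makes its harmonics contribute `w` to the norm squared.
  let c : ι → ℝ := fun i => Real.sqrt (w i) / k i
  have hc : ∀ i, 0 < c i := fun i => div_pos (Real.sqrt_pos.2 (hw i)) (hk i)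
  have hc2 : ∀ i, c i * c i = w i / k i ^ 2 := by
    intro i
    simp only [c]
    rw [div_mul_div_comm, Real.mul_self_sqrt (hw i).le]
    ring
  let A : ι × Fin 2 → Matrix m m ℂ := fun p => ((c p.1 : ℝ) : ℂ) • ![S p.1, C p.1] p.2
  let K : ι × Fin 2 → Matrix m m ℂ := fun p => (((c p.1)⁻¹ : ℝ) : ℂ) • ![P p.1, Q p.1] p.2
  have hcs := sq_norm_sum_mul_le A K
  have e1 : ∑ p, A p * K p = ∑ i, (S i * P i + C i * Q i) := by
    rw [Fintype.sum_prod_type]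
    refine Finset.sum_congr rfl fun i _ => ?_
    have : ((c i : ℝ) : ℂ) ≠ 0 := by exact_mod_cast (hc i).ne'
    simp only [A, K, Fin.sum_univ_two, smul_mul_smul_comm]
    push_cast
    rw [mul_inv_cancel₀ this, one_smul, one_smul]
  have e2 : ∑ p, A p * star (A p) =
      ∑ i, ((w i / k i ^ 2 : ℝ) : ℂ) • (S i * star (S i) + C i * star (C i)) := by
    rw [Fintype.sum_prod_type]
    refine Finset.sum_congr rfl fun i _ => ?_
    rw [← hc2]
    simp only [A, Fin.sum_univ_two, star_smul, smul_mul_smul_comm, Complex.star_def,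
      Complex.conj_ofReal]
    push_cast
    rw [smul_add]
  have e3 : ∑ p, star (K p) * K p =
      ∑ i, ((k i ^ 2 / w i : ℝ) : ℂ) • (star (P i) * P i + star (Q i) * Q i) := by
    rw [Fintype.sum_prod_type]
    refine Finset.sum_congr rfl fun i _ => ?_
    have : k i ^ 2 / w i = (c i)⁻¹ * (c i)⁻¹ := by
      rw [← mul_inv, hc2, inv_div]
    rw [this]
    simp only [K, Fin.sum_univ_two, star_smul, smul_mul_smul_comm, Complex.star_def,
      Complex.conj_ofReal]
    push_cast
    rw [smul_add]
  have h2 : ‖∑ p, A p * star (A p)‖ ≤ M * η ^ 2 := by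
    rw [e2]
    refine (norm_sum_le _ _).trans ?_
    calc ∑ i, ‖((w i / k i ^ 2 : ℝ) : ℂ) • (S i * star (S i) + C i * star (C i))‖
        ≤ ∑ i, w i * η ^ 2 := by
          refine Finset.sum_le_sum fun i _ => ?_
          have hpos : 0 < w i / k i ^ 2 := div_pos (hw i) (pow_pos (hk i) 2)
          rw [norm_smul, Complex.norm_real, Real.norm_of_nonneg hpos.le]
          refine (mul_le_mul_of_nonneg_left (hrow i) hpos.le).trans (le_of_eq ?_)
          have := (hk i).ne'
          field_simp
      _ = (∑ i, w i) * η ^ 2 := by rw [Finset.sum_mul]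
      _ ≤ M * η ^ 2 := by gcongr
  rw [e1] at hcs
  rw [e3] at hcs
  have h3 : ‖∑ i, (S i * P i + C i * Q i)‖ ^ 2 ≤ (M * η) ^ 2 := by
    refine hcs.trans ?_
    calc _ ≤ (M * η ^ 2) * M := mul_le_mul h2 hcol (norm_nonneg _) (by positivity)
      _ = _ := by ring
  exact le_of_sq_le_sq h3 (by positivity)

end CauchySchwarz

/-! ### Approximation of `g` and `h` by trigonometric polynomials -/

section Approximation

/-- The coefficients of `sin kx` in `f`, for `k = 1, …, 5`. -/
noncomputable def sinCoeff : Fin 5 → ℝ := ![150 / 128, 0, 25 / 128, 0, 3 / 128]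

/-- The coefficients of `cos kx` in `hPoly`, for `k = 1, …, 5`: roundings of the Fourier
coefficients of `h`. -/
noncomputable def cosCoeff : Fin 5 → ℝ := ![9 / 25, 1 / 4, 33 / 250, 93 / 2000, 3 / 400]

theorem sinCoeff_zero : sinCoeff 0 = 150 / 128 := rfl

theorem sinCoeff_one : sinCoeff 1 = 0 := rfl

theorem sinCoeff_two : sinCoeff 2 = 25 / 128 := rfl

theorem sinCoeff_three : sinCoeff 3 = 0 := rfl

theorem sinCoeff_four : sinCoeff 4 = 3 / 128 := rfl

theorem cosCoeff_zero : cosCoeff 0 = 9 / 25 := rfl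

theorem cosCoeff_one : cosCoeff 1 = 1 / 4 := rfl

theorem cosCoeff_two : cosCoeff 2 = 33 / 250 := rfl

theorem cosCoeff_three : cosCoeff 3 = 93 / 2000 := rfl

theorem cosCoeff_four : cosCoeff 4 = 3 / 400 := rfl

/-- A trigonometric polynomial that is uniformly close to `h`. -/
noncomputable def hPoly (x : ℝ) : ℝ :=
  403 / 2000 + ∑ i : Fin 5, cosCoeff i * Real.cos (((i + 1 : ℕ) : ℝ) * x)

/-- The trigonometric polynomial `hPoly (x + π)`, which is uniformly close to `g`. -/
noncomputable def gPoly (x : ℝ) : ℝ :=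
  403 / 2000 + ∑ i : Fin 5, (-1) ^ ((i : ℕ) + 1) * cosCoeff i * Real.cos (((i + 1 : ℕ) : ℝ) * x)

/-- `hPoly` as a polynomial in `cos x`. -/
noncomputable def hPolyCos (t : ℝ) : ℝ :=
  403 / 2000 + 9 / 25 * t + 1 / 4 * (2 * t ^ 2 - 1) + 33 / 250 * (4 * t ^ 3 - 3 * t) +
    93 / 2000 * (8 * t ^ 4 - 8 * t ^ 2 + 1) + 3 / 400 * (16 * t ^ 5 - 20 * t ^ 3 + 5 * t)

theorem f_eq_sum (x : ℝ) : f x = ∑ i : Fin 5, sinCoeff i * Real.sin (((i + 1 : ℕ) : ℝ) * x) := by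
  simp only [Fin.sum_univ_five, sinCoeff_zero, sinCoeff_one, sinCoeff_two, sinCoeff_three,
    sinCoeff_four, f]
  norm_num
  ring

theorem cos_four_mul (x : ℝ) :
    Real.cos (4 * x) = 8 * Real.cos x ^ 4 - 8 * Real.cos x ^ 2 + 1 := by
  rw [show 4 * x = 2 * (2 * x) by ring, Real.cos_two_mul, Real.cos_two_mul]
  ring

theorem sin_five_mul (x : ℝ) :
    Real.sin (5 * x) = 16 * Real.sin x ^ 5 - 20 * Real.sin x ^ 3 + 5 * Real.sin x := by
  rw [show 5 * x = 3 * x + 2 * x by ring, Real.sin_add, Real.sin_three_mul, Real.cos_three_mul,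
    Real.sin_two_mul, Real.cos_two_mul]
  have e1 : Real.cos x ^ 4 = (1 - Real.sin x ^ 2) ^ 2 := by rw [← Real.cos_sq']; ring
  have e2 : Real.cos x ^ 2 = 1 - Real.sin x ^ 2 := Real.cos_sq' x
  linear_combination (8 * Real.sin x) * e1 + (-8 * Real.sin x ^ 3) * e2

theorem cos_five_mul (x : ℝ) :
    Real.cos (5 * x) = 16 * Real.cos x ^ 5 - 20 * Real.cos x ^ 3 + 5 * Real.cos x := by
  rw [show 5 * x = 3 * x + 2 * x by ring, Real.cos_add, Real.sin_three_mul, Real.cos_three_mul,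
    Real.sin_two_mul, Real.cos_two_mul]
  have e1 : Real.sin x ^ 4 = (1 - Real.cos x ^ 2) ^ 2 := by rw [← Real.sin_sq]; ring
  have e2 : Real.sin x ^ 2 = 1 - Real.cos x ^ 2 := Real.sin_sq x
  linear_combination (8 * Real.cos x) * e1 - 6 * Real.cos x * e2

theorem hPoly_eq (x : ℝ) : hPoly x = hPolyCos (Real.cos x) := by
  simp only [hPoly, hPolyCos, Fin.sum_univ_five, cosCoeff_zero, cosCoeff_one, cosCoeff_two,
    cosCoeff_three, cosCoeff_four]
  norm_num
  rw [Real.cos_two_mul, Real.cos_three_mul, cos_four_mul, cos_five_mul]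
  ring

theorem gPoly_eq (x : ℝ) : gPoly x = hPolyCos (-Real.cos x) := by
  simp only [gPoly, hPolyCos, Fin.sum_univ_five, cosCoeff_zero, cosCoeff_one, cosCoeff_two,
    cosCoeff_three, cosCoeff_four]
  norm_num
  rw [Real.cos_two_mul, Real.cos_three_mul, cos_four_mul, cos_five_mul]
  ring

/-- The sixth power of `cos x` splits off from `1 - f x ^ 2`, so that `√(1 - f x ^ 2)` is `|cos x|³`
times a smooth function of `cos² x`. -/
theorem one_sub_f_sq (x : ℝ) :
    1 - f x ^ 2 = Real.cos x ^ 6 * (40 + 15 * Real.cos x ^ 2 + 9 * Real.cos x ^ 4) / 64 := by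
  have e1 : f x = (15 * Real.sin x - 10 * Real.sin x ^ 3 + 3 * Real.sin x ^ 5) / 8 := by
    rw [f, Real.sin_three_mul, sin_five_mul]
    ring
  obtain ⟨u, hu⟩ : ∃ u, u = Real.sin x ^ 2 := ⟨_, rfl⟩
  have e2 : f x ^ 2 = u * (15 - 10 * u + 3 * u ^ 2) ^ 2 / 64 := by rw [e1, hu]; ring
  obtain ⟨w, hw⟩ : ∃ w, w = Real.cos x ^ 2 := ⟨_, rfl⟩
  have e3 : Real.cos x ^ 6 * (40 + 15 * Real.cos x ^ 2 + 9 * Real.cos x ^ 4) / 64 =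
      w ^ 3 * (40 + 15 * w + 9 * w ^ 2) / 64 := by rw [hw]; ring
  have e4 : u = 1 - w := by rw [hu, hw, Real.sin_sq]
  rw [e2, e3, e4]
  ring

theorem f_sq_le_one (x : ℝ) : f x ^ 2 ≤ 1 := by
  have h := one_sub_f_sq x
  have : 0 ≤ 1 - f x ^ 2 := by rw [h]; positivity
  linarith

theorem abs_f_le_one (x : ℝ) : |f x| ≤ 1 := (sq_le_one_iff_abs_le_one _).1 (f_sq_le_one x)

theorem g_nonneg (x : ℝ) : 0 ≤ g x := by
  unfold g; split_ifs <;> positivity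

theorem h_nonneg (x : ℝ) : 0 ≤ h x := by
  unfold h; split_ifs <;> positivity

theorem g_mul_h (x : ℝ) : g x * h x = 0 := by
  unfold g h; split_ifs <;> simp

theorem f_sq_add_g_sq_add_h_sq (x : ℝ) : f x ^ 2 + g x ^ 2 + h x ^ 2 = 1 := by
  have h0 : 0 ≤ 1 - f x ^ 2 := by linarith [f_sq_le_one x]
  unfold g h
  split_ifs <;> rw [Real.sq_sqrt h0] <;> ring

theorem g_le_one (x : ℝ) : g x ≤ 1 := by
  nlinarith [f_sq_add_g_sq_add_h_sq x, sq_nonneg (f x), sq_nonneg (h x), g_nonneg x]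

theorem h_le_one (x : ℝ) : h x ≤ 1 := by
  nlinarith [f_sq_add_g_sq_add_h_sq x, sq_nonneg (f x), sq_nonneg (g x), h_nonneg x]

/-- The Bernstein basis polynomials of an interval are nonnegative on it. The polynomial
inequalities below are nonnegative combinations of them, on a suitable subdivision of `[0, 1]`. -/
theorem bernstein_nonneg {l r t : ℝ} (hl : l ≤ t) (hr : t ≤ r) (i j : ℕ) :
    0 ≤ (t - l) ^ i * (r - t) ^ j :=
  mul_nonneg (pow_nonneg (sub_nonneg.2 hl) i) (pow_nonneg (sub_nonneg.2 hr) j)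

/-- On the arc where `h` vanishes, `hPoly` is small. -/
theorem abs_hPolyCos_neg_le {t : ℝ} (h0 : 0 ≤ t) (h1 : t ≤ 1) : |hPolyCos (-t)| ≤ 1 / 250 := by
  have B := bernstein_nonneg h0 h1
  rw [abs_le]
  unfold hPolyCos
  constructor
  · linarith [B 0 5, B 1 4, B 2 3, B 3 2, B 4 1, B 5 0]
  -- The subdivision points are chosen so that all Bernstein coefficients are nonnegative.
  · rcases le_total t (7 / 10) with h | h
    · have B := bernstein_nonneg h0 h
      linarith [B 0 5, B 1 4, B 2 3, B 3 2, B 4 1, B 5 0]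
    · have B := bernstein_nonneg h h1
      linarith [B 0 5, B 1 4, B 2 3, B 3 2, B 4 1, B 5 0]

/-- For `t = |cos x|`, the value `√(1 - f x ^ 2)` lies within `1 / 1000` of
`t³ (0.79 + 0.156 t² + 0.054 t⁴)`. -/
theorem abs_sqrt_sub_le {t : ℝ} (h0 : 0 ≤ t) (h1 : t ≤ 1) :
    |Real.sqrt (t ^ 6 * (40 + 15 * t ^ 2 + 9 * t ^ 4) / 64) -
      t ^ 3 * (79 / 100 + 39 / 250 * t ^ 2 + 27 / 500 * t ^ 4)| ≤ 1 / 1000 := by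
  obtain ⟨w, hw⟩ : ∃ w, w = t ^ 2 := ⟨_, rfl⟩
  have hw0 : 0 ≤ w := by rw [hw]; positivity
  have hw1 : w ≤ 1 := by rw [hw]; exact pow_le_one₀ h0 h1
  have e : t ^ 6 * (40 + 15 * t ^ 2 + 9 * t ^ 4) / 64 =
      (t ^ 3) ^ 2 * ((40 + 15 * w + 9 * w ^ 2) / 64) := by rw [hw]; ring
  have ht3 : 0 ≤ t ^ 3 := pow_nonneg h0 3
  have ht3' : t ^ 3 ≤ 1 := pow_le_one₀ h0 h1
  have key : |Real.sqrt ((40 + 15 * w + 9 * w ^ 2) / 64) -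
      (79 / 100 + 39 / 250 * w + 27 / 500 * w ^ 2)| ≤ 1 / 1000 := by
    rw [abs_le]
    constructor
    · have : 79 / 100 + 39 / 250 * w + 27 / 500 * w ^ 2 - 1 / 1000 ≤
          Real.sqrt ((40 + 15 * w + 9 * w ^ 2) / 64) := by
        refine Real.le_sqrt_of_sq_le ?_
        rcases le_total w (33 / 40) with h | h
        · have B := bernstein_nonneg hw0 h
          linarith [B 0 4, B 1 3, B 2 2, B 3 1, B 4 0]
        · have B := bernstein_nonneg h hw1
          linarith [B 0 4, B 1 3, B 2 2, B 3 1, B 4 0]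
      linarith
    · have : Real.sqrt ((40 + 15 * w + 9 * w ^ 2) / 64) ≤
          79 / 100 + 39 / 250 * w + 27 / 500 * w ^ 2 + 1 / 1000 := by
        refine Real.sqrt_le_iff.2 ⟨by positivity, ?_⟩
        rcases le_total w (17 / 20) with h | h
        · have B := bernstein_nonneg hw0 h
          linarith [B 0 4, B 1 3, B 2 2, B 3 1, B 4 0]
        · have B := bernstein_nonneg h hw1
          linarith [B 0 4, B 1 3, B 2 2, B 3 1, B 4 0]
      linarith
  rw [e, Real.sqrt_mul (by positivity), Real.sqrt_sq ht3]
  have e2 : t ^ 3 * Real.sqrt ((40 + 15 * w + 9 * w ^ 2) / 64) -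
      t ^ 3 * (79 / 100 + 39 / 250 * t ^ 2 + 27 / 500 * t ^ 4) =
      t ^ 3 * (Real.sqrt ((40 + 15 * w + 9 * w ^ 2) / 64) -
        (79 / 100 + 39 / 250 * w + 27 / 500 * w ^ 2)) := by rw [hw]; ring
  rw [e2, abs_mul, abs_of_nonneg ht3]
  exact (mul_le_of_le_one_left (abs_nonneg _) ht3').trans key

theorem abs_sqrt_sub_hPolyCos_le {t : ℝ} (h0 : 0 ≤ t) (h1 : t ≤ 1) :
    |Real.sqrt (t ^ 6 * (40 + 15 * t ^ 2 + 9 * t ^ 4) / 64) - hPolyCos t| ≤ 1 / 250 := by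
  have key : |t ^ 3 * (79 / 100 + 39 / 250 * t ^ 2 + 27 / 500 * t ^ 4) - hPolyCos t| ≤
      3 / 1000 := by
    rw [abs_le]
    unfold hPolyCos
    constructor
    · rcases le_total t (13 / 20) with h | h
      · have B := bernstein_nonneg h0 h
        linarith [B 0 7, B 1 6, B 2 5, B 3 4, B 4 3, B 5 2, B 6 1, B 7 0]
      · have B := bernstein_nonneg h h1
        linarith [B 0 7, B 1 6, B 2 5, B 3 4, B 4 3, B 5 2, B 6 1, B 7 0]
    · rcases le_total t (7 / 8) with h | h
      · have B := bernstein_nonneg h0 h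
        linarith [B 0 7, B 1 6, B 2 5, B 3 4, B 4 3, B 5 2, B 6 1, B 7 0]
      · have B := bernstein_nonneg h h1
        linarith [B 0 7, B 1 6, B 2 5, B 3 4, B 4 3, B 5 2, B 6 1, B 7 0]
  have := (abs_sub_le _ _ _).trans (add_le_add (abs_sqrt_sub_le h0 h1) key)
  linarith

theorem abs_h_sub_hPoly_le (x : ℝ) : |h x - hPoly x| ≤ 1 / 250 := by
  rw [hPoly_eq]
  unfold h
  split_ifs with hc
  · rw [one_sub_f_sq]
    exact abs_sqrt_sub_hPolyCos_le hc (Real.cos_le_one x)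
  · rw [zero_sub, abs_neg]
    have := abs_hPolyCos_neg_le (t := -Real.cos x) (by linarith) (by linarith [Real.neg_one_le_cos x])
    rwa [neg_neg] at this

theorem abs_g_sub_gPoly_le (x : ℝ) : |g x - gPoly x| ≤ 1 / 250 := by
  rw [gPoly_eq]
  unfold g
  split_ifs with hc
  · rw [zero_sub, abs_neg]
    exact abs_hPolyCos_neg_le hc (Real.cos_le_one x)
  · have := abs_sqrt_sub_hPolyCos_le (t := -Real.cos x) (by linarith)
      (by linarith [Real.neg_one_le_cos x])
    rw [one_sub_f_sq]
    have e : ∀ c : ℝ, (-c) ^ 6 * (40 + 15 * (-c) ^ 2 + 9 * (-c) ^ 4) =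
      c ^ 6 * (40 + 15 * c ^ 2 + 9 * c ^ 4) := fun c => by ring
    rwa [e] at this

end Approximation

/-! ### Norms and lower bounds of matrices -/

section Norms

variable {m : Type*} [Fintype m] [DecidableEq m]

/-- The action of a square matrix on the euclidean space. -/
noncomputable def act (A : Matrix m m ℂ) : EuclideanSpace ℂ m →L[ℂ] EuclideanSpace ℂ m :=
  Matrix.toEuclideanCLM (𝕜 := ℂ) A

theorem act_mul (A B : Matrix m m ℂ) (v : EuclideanSpace ℂ m) :
    act (A * B) v = act A (act B v) := by
  rw [act, map_mul]
  rfl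

theorem act_add (A B : Matrix m m ℂ) (v : EuclideanSpace ℂ m) :
    act (A + B) v = act A v + act B v := by
  rw [act, map_add]
  rfl

theorem act_sub (A B : Matrix m m ℂ) (v : EuclideanSpace ℂ m) :
    act (A - B) v = act A v - act B v := by
  rw [act, map_sub]
  rfl

theorem act_smul (c : ℂ) (A : Matrix m m ℂ) (v : EuclideanSpace ℂ m) :
    act (c • A) v = c • act A v := by
  rw [act, map_smul]
  rfl

theorem act_zero (v : EuclideanSpace ℂ m) : act (0 : Matrix m m ℂ) v = 0 := by
  rw [act, map_zero]
  rfl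

theorem act_one (v : EuclideanSpace ℂ m) : act (1 : Matrix m m ℂ) v = v := by
  rw [act, map_one]
  rfl

theorem act_toLp (A : Matrix m m ℂ) (x : m → ℂ) :
    act A (WithLp.toLp 2 x) = WithLp.toLp 2 (A.mulVec x) := by
  rw [act, Matrix.toEuclideanCLM_toLp]

theorem inner_act_left (A : Matrix m m ℂ) (v w : EuclideanSpace ℂ m) :
    inner ℂ (act A v) w = inner ℂ v (act (star A) w) := by
  rw [act, act, map_star, ContinuousLinearMap.star_eq_adjoint,
    ContinuousLinearMap.adjoint_inner_right]

theorem norm_act_le (A : Matrix m m ℂ) (v : EuclideanSpace ℂ m) : ‖act A v‖ ≤ ‖A‖ * ‖v‖ := by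
  rw [Matrix.cstar_norm_def]
  exact ContinuousLinearMap.le_opNorm _ _

theorem sq_norm_act (A : Matrix m m ℂ) (v : EuclideanSpace ℂ m) :
    ‖act A v‖ ^ 2 = (inner ℂ v (act (star A * A) v)).re := by
  rw [act_mul, ← star_star A, ← inner_act_left, star_star]
  exact (inner_self_eq_norm_sq (𝕜 := ℂ) _).symm

theorem abs_re_inner_act_le (A : Matrix m m ℂ) (v : EuclideanSpace ℂ m) :
    |(inner ℂ v (act A v)).re| ≤ ‖A‖ * ‖v‖ ^ 2 := by
  refine (Complex.abs_re_le_norm _).trans ((norm_inner_le_norm _ _).trans ?_)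
  nlinarith [norm_act_le A v, norm_nonneg v]

/-- A square matrix and its adjoint have the same smallest singular value. -/
theorem le_sq_norm_act_of_star {A : Matrix m m ℂ} {c : ℝ}
    (hA : ∀ v, c * ‖v‖ ^ 2 ≤ ‖act (star A) v‖ ^ 2) (v : EuclideanSpace ℂ m) :
    c * ‖v‖ ^ 2 ≤ ‖act A v‖ ^ 2 := by
  rcases le_or_gt c 0 with hc | hc
  · nlinarith [sq_nonneg ‖v‖, sq_nonneg ‖act A v‖]
  have hinj : Function.Injective (act (star A)) := by
    refine (injective_iff_map_eq_zero _).2 fun w hw => ?_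
    have := hA w
    rw [hw, norm_zero] at this
    have h2 : ‖w‖ ^ 2 ≤ 0 := by nlinarith
    exact norm_eq_zero.1 (pow_eq_zero_iff (two_ne_zero) |>.1 (le_antisymm h2 (sq_nonneg _)))
  have hunit : IsUnit (star A) := by
    rw [← Matrix.mulVec_injective_iff_isUnit]
    intro x y hxy
    have := @hinj (WithLp.toLp 2 x) (WithLp.toLp 2 y) (by
      rw [act_toLp, act_toLp, hxy])
    simpa using this
  obtain ⟨N, hN1, hN2⟩ := isUnit_iff_exists.1 hunit
  have hN : ‖N‖ ≤ (Real.sqrt c)⁻¹ := by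
    rw [Matrix.cstar_norm_def]
    refine ContinuousLinearMap.opNorm_le_bound _ (by positivity) fun w => ?_
    have h1 := hA (act N w)
    rw [← act_mul, hN1] at h1
    rw [act_one] at h1
    have h3 : Real.sqrt c * ‖act N w‖ ≤ ‖w‖ := by
      refine le_of_sq_le_sq ?_ (norm_nonneg _)
      rw [mul_pow, Real.sq_sqrt hc.le]
      exact h1
    change ‖act N w‖ ≤ _
    rw [inv_mul_eq_div, le_div_iff₀ (Real.sqrt_pos.2 hc)]
    linarith
  have h1 : act (star N) (act A v) = v := by
    rw [← act_mul, ← star_star A, ← star_mul, hN1, star_one, act_one]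
  have h2 := norm_act_le (star N) (act A v)
  rw [h1, norm_star] at h2
  have h3 : ‖v‖ ≤ (Real.sqrt c)⁻¹ * ‖act A v‖ :=
    h2.trans (mul_le_mul_of_nonneg_right hN (norm_nonneg _))
  rw [inv_mul_eq_div, le_div_iff₀ (Real.sqrt_pos.2 hc)] at h3
  have h4 := pow_le_pow_left₀ (by positivity) h3 2
  rw [mul_pow, Real.sq_sqrt hc.le] at h4
  linarith

theorem exists_act_eq_smul {S : Matrix m m ℂ} {z : ℂ} (hz : z ∈ spectrum ℂ S) :
    ∃ v : EuclideanSpace ℂ m, v ≠ 0 ∧ act S v = z • v := by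
  rw [← Matrix.spectrum_toLin', ← Module.End.hasEigenvalue_iff_mem_spectrum] at hz
  obtain ⟨x, hx⟩ := hz.exists_hasEigenvector
  refine ⟨WithLp.toLp 2 x, ?_, ?_⟩
  · simpa using hx.2
  · have := hx.apply_eq_smul
    rw [Matrix.toLin'_apply] at this
    rw [act_toLp, this]
    rfl

theorem norm_le_of_forall_spectrum {S : Matrix m m ℂ} (hS : IsSelfAdjoint S) {c : ℝ} (hc : 0 ≤ c)
    (h : ∀ z ∈ spectrum ℂ S, ‖z‖ ≤ c) : ‖S‖ ≤ c := by
  have : IsStarNormal S := hS.isStarNormal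
  rw [← cfc_id' ℂ S]
  exact norm_cfc_le hc h

/-- The block diagonal matrices as a `*`-homomorphism, which is therefore contractive. -/
noncomputable def blockDiagHom : (Matrix m m ℂ × Matrix m m ℂ) →⋆ₐ[ℂ] Matrix (m ⊕ m) (m ⊕ m) ℂ where
  toFun p := Matrix.fromBlocks p.1 0 0 p.2
  map_one' := Matrix.fromBlocks_one
  map_mul' p q := by simp [Matrix.fromBlocks_multiply]
  map_zero' := Matrix.fromBlocks_zero
  map_add' p q := by simp [Matrix.fromBlocks_add]
  commutes' r := by
    simp only [Algebra.algebraMap_eq_smul_one, Prod.smul_fst, Prod.smul_snd, Prod.fst_one,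
      Prod.snd_one]
    rw [← Matrix.fromBlocks_one, Matrix.fromBlocks_smul, smul_zero]
  map_star' p := by
    simp [Matrix.star_eq_conjTranspose, Matrix.fromBlocks_conjTranspose]

theorem norm_fromBlocks_diagonal_le {A D : Matrix m m ℂ} {c : ℝ} (hA : ‖A‖ ≤ c) (hD : ‖D‖ ≤ c) :
    ‖Matrix.fromBlocks A 0 0 D‖ ≤ c := by
  have := NonUnitalStarAlgHom.norm_apply_le (blockDiagHom (m := m)) (A, D)
  exact this.trans (max_le hA hD)

theorem norm_fromBlocks_antidiagonal_le {A D : Matrix m m ℂ} {c : ℝ} (hA : ‖A‖ ≤ c)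
    (hD : ‖D‖ ≤ c) : ‖Matrix.fromBlocks 0 A D 0‖ ≤ c := by
  have e : Matrix.fromBlocks 0 A D 0 =
      Matrix.fromBlocks A 0 0 D * (Matrix.fromBlocks 0 1 1 0 : Matrix (m ⊕ m) (m ⊕ m) ℂ) := by
    simp [Matrix.fromBlocks_multiply]
  have hs : (Matrix.fromBlocks 0 1 1 0 : Matrix (m ⊕ m) (m ⊕ m) ℂ) ∈
      Matrix.unitaryGroup (m ⊕ m) ℂ := by
    rw [Matrix.mem_unitaryGroup_iff, Matrix.star_eq_conjTranspose,
      Matrix.fromBlocks_conjTranspose, Matrix.fromBlocks_multiply, ← Matrix.fromBlocks_one]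
    simp
  rw [e]
  have hc : 0 ≤ c := (norm_nonneg _).trans hA
  calc _ ≤ ‖Matrix.fromBlocks A 0 0 D‖ *
        ‖(Matrix.fromBlocks 0 1 1 0 : Matrix (m ⊕ m) (m ⊕ m) ℂ)‖ := norm_mul_le _ _
    _ ≤ c * 1 := mul_le_mul (norm_fromBlocks_diagonal_le hA hD)
        (norm_le_one_of_mem_unitaryGroup hs) (norm_nonneg _) hc
    _ = c := mul_one c

end Norms

/-! ### The spectral gap -/

section Gap

variable {m : Type*} [Fintype m] {F G H U : Matrix m m ℂ}

/-- The matrix `T` whose hermitian part is `B`: it is `F σ_z + G σ_x + H W` with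
`W = [[0, U], [U*, 0]]`. -/
def halfMat (F G H U : Matrix m m ℂ) : Matrix (m ⊕ m) (m ⊕ m) ℂ :=
  Matrix.fromBlocks F (G + H * U) (G + H * star U) (-F)

theorem star_halfMat (hF : star F = F) (hG : star G = G) (hH : star H = H) :
    star (halfMat F G H U) = Matrix.fromBlocks F (G + U * H) (G + star U * H) (-F) := by
  rw [halfMat, Matrix.star_eq_conjTranspose, Matrix.fromBlocks_conjTranspose]
  simp only [← Matrix.star_eq_conjTranspose, star_add, star_mul, star_neg, star_star, hF, hG, hH]

variable [DecidableEq m]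

/-- A positive contraction `A` satisfies `⟪A x, x⟫ ≥ ‖A x‖²`. -/
theorem exists_sq_norm_act_le_inner {A J : Matrix m m ℂ} (hA : star A = A)
    (hJ : A = A * A + star J * J) (x : EuclideanSpace ℂ m) :
    ∃ r : ℝ, ‖act A x‖ ^ 2 ≤ r ∧ inner ℂ (act A x) x = (r : ℂ) := by
  refine ⟨‖act A x‖ ^ 2 + ‖act J x‖ ^ 2, by nlinarith [sq_nonneg ‖act J x‖], ?_⟩
  have e : act A x = act (star A) (act A x) + act (star J) (act J x) := by
    rw [← act_mul, ← act_mul, ← act_add, hA, ← hJ]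
  conv_lhs => rw [e]
  rw [inner_add_left, inner_act_left (star A), inner_act_left (star J), star_star, star_star,
    inner_self_eq_norm_sq_to_K, inner_self_eq_norm_sq_to_K]
  simp

/-- If `G` and `H` are orthogonal positive contractions, then `G U H + H U* G` is controlled by
the commutator of `U` with `H - G`, with a gain of a factor two: for an eigenvector
`p + q` of `G U H + H U* G` with `p ∈ range G` and `q ∈ range H`, and an eigenvalue `z`, the number
`⟪p, [U, H - G] q⟫` has absolute value at least `|z| (‖p‖² + ‖q‖²)`. The matrices `K` and `L` are
square roots of `G - G²` and `H - H²`. -/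
theorem norm_mul_mul_add_le {K L : Matrix m m ℂ} (hG : star G = G) (hH : star H = H)
    (hGH : G * H = 0) (hK : G = G * G + star K * K) (hL : H = H * H + star L * L) :
    ‖G * U * H + H * star U * G‖ ≤ ‖U * (H - G) - (H - G) * U‖ / 2 := by
  have hHG : H * G = 0 := by
    have := congrArg star hGH
    rwa [star_mul, hG, hH, star_zero] at this
  obtain ⟨N, hN⟩ : ∃ N, N = U * (H - G) - (H - G) * U := ⟨_, rfl⟩
  obtain ⟨S, hS⟩ : ∃ S, S = G * U * H + H * star U * G := ⟨_, rfl⟩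
  rw [← hN, ← hS]
  have hSa : IsSelfAdjoint S := by
    rw [IsSelfAdjoint, hS]
    simp only [star_add, star_mul, star_star, hG, hH]
    rw [add_comm]; noncomm_ring
  refine norm_le_of_forall_spectrum hSa (by positivity) fun z hz => ?_
  rcases eq_or_ne z 0 with rfl | hz0
  · rw [norm_zero]; positivity
  have hzr : star z = z := by
    have h2 := hSa.mem_spectrum_eq_re hz
    rw [h2, Complex.star_def, Complex.conj_ofReal]
  obtain ⟨v, hv0, hv⟩ := exists_act_eq_smul hz
  have hGHv : ∀ x, act G (act H x) = 0 := fun x => by rw [← act_mul, hGH, act_zero]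
  have hHGv : ∀ x, act H (act G x) = 0 := fun x => by rw [← act_mul, hHG, act_zero]
  obtain ⟨a, ha⟩ : ∃ a, a = act U (act H v) := ⟨_, rfl⟩
  obtain ⟨b, hb⟩ : ∃ b, b = act (star U) (act G v) := ⟨_, rfl⟩
  obtain ⟨p, hp⟩ : ∃ p, p = act G a := ⟨_, rfl⟩
  obtain ⟨q, hq⟩ : ∃ q, q = act H b := ⟨_, rfl⟩
  have hpq : z • v = p + q := by
    rw [← hv, hS, hp, hq, ha, hb]
    simp only [act_add, act_mul]
  have hGq : act G q = 0 := by rw [hq, hGHv]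
  have hHp : act H p = 0 := by rw [hp, hHGv]
  have h1 : act U (act H q) = z • a := by
    rw [ha, ← map_smul, ← map_smul, hpq, map_add, hHp, zero_add]
  have h2 : act (star U) (act G p) = z • b := by
    rw [hb, ← map_smul, ← map_smul, hpq, map_add, hGq, add_zero]
  obtain ⟨r, hr1, hr2⟩ := exists_sq_norm_act_le_inner hG hK a
  obtain ⟨s, hs1, hs2⟩ := exists_sq_norm_act_le_inner hH hL b
  rw [← hp] at hr1 hr2
  rw [← hq] at hs1 hs2
  -- Of the four terms of `⟪p, [U, H - G] q⟫`, the two with `G q` and `H p` vanish.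
  have h3 : inner ℂ p (act N q) = z * ((r + s : ℝ) : ℂ) := by
    have e1 : act N q = z • a + act G (act U q) - act H (act U q) := by
      have : act N q = act U (act H q) - act U (act G q) -
          (act H (act U q) - act G (act U q)) := by
        rw [hN]
        simp only [act_sub, act_mul, map_sub]
      rw [this, h1, hGq, map_zero]
      abel
    have e2 : inner ℂ p (act H (act U q)) = 0 := by
      rw [← hH, ← inner_act_left, hHp, inner_zero_left]
    have e3 : inner ℂ p (act G (act U q)) = z * (s : ℂ) := by
      have hsr : inner ℂ b q = (s : ℂ) := by
        rw [← inner_conj_symm, hs2, Complex.conj_ofReal]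
      rw [← hG, ← inner_act_left, ← star_star U, ← inner_act_left, h2, inner_smul_left, hsr]
      rw [← Complex.star_def, hzr]
    rw [e1, inner_sub_right, inner_add_right, inner_smul_right, hr2, e2, e3]
    push_cast
    ring
  have h4 : ‖z‖ * (r + s) ≤ ‖N‖ * (‖p‖ * ‖q‖) := by
    have h5 : ‖inner ℂ p (act N q)‖ = ‖z‖ * (r + s) := by
      rw [h3, norm_mul, Complex.norm_real, Real.norm_of_nonneg]
      nlinarith [sq_nonneg ‖p‖, sq_nonneg ‖q‖]
    rw [← h5]
    refine (norm_inner_le_norm _ _).trans ?_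
    have := mul_le_mul_of_nonneg_left (norm_act_le N q) (norm_nonneg p)
    linarith
  have h6 : 0 < ‖p‖ ^ 2 + ‖q‖ ^ 2 := by
    by_contra hcon
    have hp0 : ‖p‖ = 0 := by nlinarith [sq_nonneg ‖p‖, sq_nonneg ‖q‖]
    have hq0 : ‖q‖ = 0 := by nlinarith [sq_nonneg ‖p‖, sq_nonneg ‖q‖]
    rw [norm_eq_zero] at hp0 hq0
    rw [hp0, hq0, add_zero] at hpq
    exact (smul_ne_zero hz0 hv0) hpq
  have h7 : ‖z‖ * (‖p‖ ^ 2 + ‖q‖ ^ 2) ≤ ‖N‖ / 2 * (‖p‖ ^ 2 + ‖q‖ ^ 2) := by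
    have e1 := mul_le_mul_of_nonneg_left (add_le_add hr1 hs1) (norm_nonneg z)
    have e2 : ‖p‖ * ‖q‖ ≤ (‖p‖ ^ 2 + ‖q‖ ^ 2) / 2 := by linarith [two_mul_le_add_sq ‖p‖ ‖q‖]
    calc ‖z‖ * (‖p‖ ^ 2 + ‖q‖ ^ 2) ≤ ‖N‖ * (‖p‖ * ‖q‖) := e1.trans h4
      _ ≤ ‖N‖ * ((‖p‖ ^ 2 + ‖q‖ ^ 2) / 2) := mul_le_mul_of_nonneg_left e2 (norm_nonneg N)
      _ = _ := by ring
  exact le_of_mul_le_mul_right h7 h6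

theorem halfMat_mul_star (hF : star F = F) (hG : star G = G) (hH : star H = H)
    (hFG : F * G = G * F) (hsum : F * F + G * G + H * H = 1)
    (hU : U ∈ Matrix.unitaryGroup m ℂ) :
    halfMat F G H U * star (halfMat F G H U) = 1 +
      Matrix.fromBlocks 0 (F * U * H - H * U * F) (star (F * U * H - H * U * F)) 0 +
      Matrix.fromBlocks (G * star U * H + H * star (star U) * G) 0 0
        (G * U * H + H * star U * G) := by
  have hU1 := Unitary.star_mul_self_of_mem hU
  have hU2 := Unitary.mul_star_self_of_mem hU
  have hU1' : ∀ X, star U * (U * X) = X := fun X => by rw [← mul_assoc, hU1, one_mul]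
  have hU2' : ∀ X, U * (star U * X) = X := fun X => by rw [← mul_assoc, hU2, one_mul]
  rw [star_halfMat hF hG hH, halfMat, Matrix.fromBlocks_multiply, ← Matrix.fromBlocks_one,
    Matrix.fromBlocks_add, Matrix.fromBlocks_add, star_sub, star_star]
  simp only [star_mul, hF, hH]
  congr 1
  · rw [← hsum]
    simp only [mul_add, add_mul, mul_assoc, hU2']
    abel
  · simp only [mul_add, add_mul, mul_neg, mul_assoc, hFG, zero_add, add_zero]
    abel
  · simp only [mul_add, add_mul, neg_mul, mul_assoc, hFG, zero_add, add_zero]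
    abel
  · rw [← hsum]
    simp only [mul_add, add_mul, mul_assoc, hU1', neg_mul, mul_neg, neg_neg]
    abel

/-- The spectral gap of the hermitian part `B = (T + T*) / 2` of `T = F σ_z + G σ_x + H W`. The
parallelogram law expresses `‖B v‖²` by `‖T v‖²`, `‖T* v‖²` and the commutator
`T - T* = [H, W]`. As `T T*` and `T* T` have the same spectrum, it suffices to bound `T T*`. -/
theorem le_sq_norm_act_half_add_star {m₁ m₂ c : ℝ} (hF : star F = F) (hG : star G = G)
    (hH : star H = H) (hFG : F * G = G * F)
    (hsum : F * F + G * G + H * H = 1) (hU : U ∈ Matrix.unitaryGroup m ℂ)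
    (h₁ : ‖F * U * H - H * U * F‖ ≤ m₁) (h₂ : ‖G * U * H + H * star U * G‖ ≤ m₂)
    (h₂' : ‖G * star U * H + H * star (star U) * G‖ ≤ m₂) (hc : ‖H * U - U * H‖ ≤ c)
    (v : EuclideanSpace ℂ (m ⊕ m)) :
    (1 - m₁ - m₂ - c ^ 2 / 4) * ‖v‖ ^ 2 ≤
      ‖act ((1 / 2 : ℂ) • (halfMat F G H U + star (halfMat F G H U))) v‖ ^ 2 := by
  obtain ⟨T, hT⟩ : ∃ T, T = halfMat F G H U := ⟨_, rfl⟩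
  have hstar : ∀ w, (1 - m₁ - m₂) * ‖w‖ ^ 2 ≤ ‖act (star T) w‖ ^ 2 := by
    intro w
    have h3 := halfMat_mul_star hF hG hH hFG hsum hU
    rw [← hT] at h3
    rw [sq_norm_act, star_star, h3]
    have h₁' : ‖star (F * U * H - H * U * F)‖ ≤ m₁ := (norm_star _).trans_le h₁
    have e3 := norm_fromBlocks_antidiagonal_le h₁ h₁'
    have e4 := norm_fromBlocks_diagonal_le h₂' h₂
    generalize Matrix.fromBlocks 0 (F * U * H - H * U * F) (star (F * U * H - H * U * F)) 0 = Y at *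
    generalize Matrix.fromBlocks (G * star U * H + H * star (star U) * G) 0 0
        (G * U * H + H * star U * G) = Z at *
    have e6 : (inner ℂ w w).re = ‖w‖ ^ 2 := inner_self_eq_norm_sq (𝕜 := ℂ) w
    rw [act_add, act_add, act_one, inner_add_right, inner_add_right, Complex.add_re,
      Complex.add_re, e6]
    have e7 := (abs_le.1 (abs_re_inner_act_le Y w)).1
    have e8 := (abs_le.1 (abs_re_inner_act_le Z w)).1
    have e9 := mul_le_mul_of_nonneg_right e3 (sq_nonneg ‖w‖)
    have e10 := mul_le_mul_of_nonneg_right e4 (sq_nonneg ‖w‖)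
    linarith
  have h1 := hstar v
  have h2 := le_sq_norm_act_of_star hstar v
  have hcomm : ‖T - star T‖ ≤ c := by
    have e : T - star T = Matrix.fromBlocks 0 (H * U - U * H) (-star (H * U - U * H)) 0 := by
      rw [hT, star_halfMat hF hG hH, halfMat, sub_eq_add_neg, Matrix.fromBlocks_neg,
        Matrix.fromBlocks_add, star_sub, star_mul, star_mul, hH]
      congr 1 <;> abel
    rw [e]
    exact norm_fromBlocks_antidiagonal_le hc (by rwa [norm_neg, norm_star])
  -- `T v` and `T* v` have sum `2 B v` and difference `[H, W] v`.
  have h3 := parallelogram_law_with_norm ℂ (act T v) (act (star T) v)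
  have e1 : act T v + act (star T) v = (2 : ℂ) • act ((1 / 2 : ℂ) • (T + star T)) v := by
    rw [act_smul, act_add, smul_smul]
    norm_num
  have e2 : act T v - act (star T) v = act (T - star T) v := by
    rw [act_sub]
  rw [e1, e2, norm_smul] at h3
  have h4 := norm_act_le (T - star T) v
  have h5 : ‖act (T - star T) v‖ ^ 2 ≤ c ^ 2 * ‖v‖ ^ 2 := by
    rw [← mul_pow]
    exact pow_le_pow_left₀ (norm_nonneg _)
      (h4.trans (mul_le_mul_of_nonneg_right hcomm (norm_nonneg _))) 2
  have h6 : ‖(2 : ℂ)‖ = 2 := by norm_num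
  rw [h6] at h3
  rw [← hT]
  nlinarith

end Gap

/-! ### Signatures of nearby hermitian matrices -/

section Signature

variable {ι : Type*} [Fintype ι] [DecidableEq ι] {A A' : Matrix ι ι ℂ}

theorem act_eigenvectorBasis (hA : A.IsHermitian) (i : ι) :
    act A (hA.eigenvectorBasis i) = (hA.eigenvalues i : ℂ) • hA.eigenvectorBasis i := by
  have h := hA.mulVec_eigenvectorBasis i
  have e : hA.eigenvectorBasis i = WithLp.toLp 2 (hA.eigenvectorBasis i).ofLp := rfl
  rw [e, act_toLp, h]
  rfl

theorem re_inner_act_eq_sum (hA : A.IsHermitian) (v : EuclideanSpace ℂ ι) :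
    (inner ℂ v (act A v)).re =
      ∑ i, hA.eigenvalues i * ‖inner ℂ (hA.eigenvectorBasis i) v‖ ^ 2 := by
  rw [← hA.eigenvectorBasis.sum_inner_mul_inner v (act A v), Complex.re_sum]
  refine Finset.sum_congr rfl fun i _ => ?_
  have h1 : inner ℂ (hA.eigenvectorBasis i) (act A v) =
      (hA.eigenvalues i : ℂ) * inner ℂ (hA.eigenvectorBasis i) v := by
    have hs : star A = A := hA
    have h2 := inner_act_left A (hA.eigenvectorBasis i) v
    rw [hs, act_eigenvectorBasis, inner_smul_left, Complex.conj_ofReal] at h2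
    exact h2.symm
  rw [h1, ← inner_conj_symm v]
  have h2 : (starRingEnd ℂ) (inner ℂ (hA.eigenvectorBasis i) v) *
      ((hA.eigenvalues i : ℂ) * inner ℂ (hA.eigenvectorBasis i) v) =
      ((hA.eigenvalues i * ‖inner ℂ (hA.eigenvectorBasis i) v‖ ^ 2 : ℝ) : ℂ) := by
    rw [mul_left_comm, Complex.conj_mul']
    push_cast
    ring
  rw [h2, Complex.ofReal_re]

theorem le_abs_eigenvalues (hA : A.IsHermitian) {γ : ℝ}
    (hγA : ∀ v, γ ^ 2 * ‖v‖ ^ 2 ≤ ‖act A v‖ ^ 2) (i : ι) : γ ≤ |hA.eigenvalues i| := by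
  have h := hγA (hA.eigenvectorBasis i)
  rw [act_eigenvectorBasis, norm_smul, Complex.norm_real, Real.norm_eq_abs,
    hA.eigenvectorBasis.orthonormal.1 i, mul_one, one_pow, mul_one] at h
  exact (le_abs_self γ).trans (sq_le_sq.1 (h.trans_eq (sq_abs _)))

/-- The span of the eigenvectors of a hermitian matrix whose eigenvalues satisfy `p`. -/
noncomputable def eigenSpan (hA : A.IsHermitian) (p : ℝ → Prop) :
    Submodule ℂ (EuclideanSpace ℂ ι) :=
  Submodule.span ℂ (Set.range fun i : {i // p (hA.eigenvalues i)} => hA.eigenvectorBasis i)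

theorem finrank_eigenSpan (hA : A.IsHermitian) (p : ℝ → Prop) :
    Module.finrank ℂ (eigenSpan hA p) = Nat.card {i // p (hA.eigenvalues i)} := by
  classical
  have := hA.eigenvectorBasis.orthonormal.linearIndependent.comp
    (Subtype.val : {i // p (hA.eigenvalues i)} → ι) Subtype.val_injective
  rw [Nat.card_eq_fintype_card]
  exact finrank_span_eq_card this

theorem inner_eq_zero_of_mem_eigenSpan (hA : A.IsHermitian) {p : ℝ → Prop}
    {v : EuclideanSpace ℂ ι} (hv : v ∈ eigenSpan hA p) {j : ι} (hj : ¬ p (hA.eigenvalues j)) :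
    inner ℂ (hA.eigenvectorBasis j) v = 0 := by
  induction hv using Submodule.span_induction with
  | mem x hx =>
    obtain ⟨i, rfl⟩ := hx
    exact hA.eigenvectorBasis.orthonormal.2 fun h => hj (h ▸ i.2)
  | zero => exact inner_zero_right _
  | add x y _ _ hx hy => rw [inner_add_right, hx, hy, add_zero]
  | smul c x _ hx => rw [inner_smul_right, hx, mul_zero]

theorem le_re_inner_act_of_mem_eigenSpan (hA : A.IsHermitian) {γ : ℝ}
    (hγA : ∀ v, γ ^ 2 * ‖v‖ ^ 2 ≤ ‖act A v‖ ^ 2) {v : EuclideanSpace ℂ ι}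
    (hv : v ∈ eigenSpan hA (0 < ·)) : γ * ‖v‖ ^ 2 ≤ (inner ℂ v (act A v)).re := by
  rw [re_inner_act_eq_sum hA, ← hA.eigenvectorBasis.sum_sq_norm_inner_right v, Finset.mul_sum]
  refine Finset.sum_le_sum fun i _ => ?_
  by_cases hi : 0 < hA.eigenvalues i
  · have := le_abs_eigenvalues hA hγA i
    rw [abs_of_pos hi] at this
    exact mul_le_mul_of_nonneg_right this (sq_nonneg _)
  · rw [inner_eq_zero_of_mem_eigenSpan hA hv hi]
    simp

theorem re_inner_act_le_of_mem_eigenSpan (hA : A.IsHermitian) {γ : ℝ}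
    (hγA : ∀ v, γ ^ 2 * ‖v‖ ^ 2 ≤ ‖act A v‖ ^ 2) {v : EuclideanSpace ℂ ι}
    (hv : v ∈ eigenSpan hA (· < 0)) : (inner ℂ v (act A v)).re ≤ -(γ * ‖v‖ ^ 2) := by
  rw [re_inner_act_eq_sum hA, ← hA.eigenvectorBasis.sum_sq_norm_inner_right v, Finset.mul_sum,
    ← Finset.sum_neg_distrib]
  refine Finset.sum_le_sum fun i _ => ?_
  by_cases hi : hA.eigenvalues i < 0
  · have := le_abs_eigenvalues hA hγA i
    rw [abs_of_neg hi] at this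
    rw [← neg_mul]
    exact mul_le_mul_of_nonneg_right (by linarith) (sq_nonneg _)
  · rw [inner_eq_zero_of_mem_eigenSpan hA hv hi]
    simp

theorem add_le_norm_sub_of_card_lt (hA : A.IsHermitian) (hA' : A'.IsHermitian) {γ γ' : ℝ}
    (hγA : ∀ v, γ ^ 2 * ‖v‖ ^ 2 ≤ ‖act A v‖ ^ 2) (hγA' : ∀ v, γ' ^ 2 * ‖v‖ ^ 2 ≤ ‖act A' v‖ ^ 2)
    (hcard : Fintype.card ι < Nat.card {i // 0 < hA.eigenvalues i} +
      Nat.card {i // hA'.eigenvalues i < 0}) : γ + γ' ≤ ‖A - A'‖ := by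
  have hne : ¬ Disjoint (eigenSpan hA (0 < ·)) (eigenSpan hA' (· < 0)) := by
    intro hd
    have := Submodule.finrank_add_finrank_le_of_disjoint hd
    rw [finrank_eigenSpan, finrank_eigenSpan, finrank_euclideanSpace] at this
    omega
  rw [Submodule.disjoint_def] at hne
  push Not at hne
  obtain ⟨v, hv, hv', hv0⟩ := hne
  have h1 := le_re_inner_act_of_mem_eigenSpan hA hγA hv
  have h2 := re_inner_act_le_of_mem_eigenSpan hA' hγA' hv'
  have h3 := (abs_le.1 (abs_re_inner_act_le (A - A') v)).2
  rw [act_sub, inner_sub_right, Complex.sub_re] at h3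
  have h4 : 0 < ‖v‖ ^ 2 := pow_pos (norm_pos_iff.2 hv0) 2
  refine le_of_mul_le_mul_right ?_ h4
  linarith

theorem card_pos_add_card_neg (hA : A.IsHermitian) (h : ∀ i, hA.eigenvalues i ≠ 0) :
    Nat.card {i // 0 < hA.eigenvalues i} + Nat.card {i // hA.eigenvalues i < 0} =
      Fintype.card ι := by
  classical
  have h1 := Fintype.card_subtype_compl (fun i => 0 < hA.eigenvalues i)
  have h2 : Fintype.card {i // ¬ 0 < hA.eigenvalues i} =
      Fintype.card {i // hA.eigenvalues i < 0} :=
    Fintype.card_congr (Equiv.subtypeEquivRight fun i =>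
      ⟨fun hi => lt_of_le_of_ne (not_lt.1 hi) (h i), fun hi => not_lt.2 hi.le⟩)
  have h3 := Fintype.card_subtype_le (fun i => 0 < hA.eigenvalues i)
  rw [Nat.card_eq_fintype_card, Nat.card_eq_fintype_card]
  omega

/-- Hermitian matrices with spectral gaps `γ` and `γ'` around `0` and with different signatures
have distance at least `γ + γ'`: by a count of dimensions, some vector lies both in the positive
subspace of one and in the negative subspace of the other. -/
theorem add_le_norm_sub_of_sig_ne (hA : A.IsHermitian) (hA' : A'.IsHermitian) {γ γ' : ℝ}
    (hγ : 0 < γ) (hγ' : 0 < γ')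
    (hγA : ∀ v, γ ^ 2 * ‖v‖ ^ 2 ≤ ‖act A v‖ ^ 2) (hγA' : ∀ v, γ' ^ 2 * ‖v‖ ^ 2 ≤ ‖act A' v‖ ^ 2)
    (hne : Sig hA ≠ Sig hA') : γ + γ' ≤ ‖A - A'‖ := by
  have h1 := card_pos_add_card_neg hA fun i =>
    abs_pos.1 (hγ.trans_le (le_abs_eigenvalues hA hγA i))
  have h2 := card_pos_add_card_neg hA' fun i =>
    abs_pos.1 (hγ'.trans_le (le_abs_eigenvalues hA' hγA' i))
  unfold Sig at hne
  rcases lt_trichotomy (Nat.card {i // 0 < hA.eigenvalues i})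
    (Nat.card {i // 0 < hA'.eigenvalues i}) with h | h | h
  · rw [norm_sub_rev, add_comm]
    exact add_le_norm_sub_of_card_lt hA' hA hγA' hγA (by omega)
  · exact absurd (by omega) hne
  · exact add_le_norm_sub_of_card_lt hA hA' hγA hγA' (by omega)

end Signature

/-! ### Commutator estimates for the entries of `B` -/

section Expansion

variable {d : ℕ} {V : Matrix (Fin d) (Fin d) ℂ}

theorem angleCalc_sum {ι : Type*} [Fintype ι] (q : ι → ℝ → ℝ) (V : Matrix (Fin d) (Fin d) ℂ) :
    angleCalc (fun x => ∑ i, q i x) V = ∑ i, angleCalc (q i) V := by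
  unfold angleCalc
  rw [← cfc_sum_univ _ _ fun i => continuousOn_spectrum _ V]
  congr 1
  funext z
  simp

theorem angleCalc_f_eq (hV : V ∈ Matrix.unitaryGroup (Fin d) ℂ) :
    angleCalc f V = ∑ i : Fin 5, (sinCoeff i : ℂ) • sinMat (i + 1 : ℕ) V := by
  rw [funext f_eq_sum, angleCalc_sum]
  refine Finset.sum_congr rfl fun i _ => ?_
  rw [angleCalc_const_mul, angleCalc_sin hV]

theorem angleCalc_const_add_sum_cos (hV : V ∈ Matrix.unitaryGroup (Fin d) ℂ) (c : ℝ)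
    (a : Fin 5 → ℝ) :
    angleCalc (fun x => c + ∑ i : Fin 5, a i * Real.cos (((i + 1 : ℕ) : ℝ) * x)) V =
      (c : ℂ) • 1 + ∑ i : Fin 5, (a i : ℂ) • cosMat (i + 1 : ℕ) V := by
  rw [angleCalc_add, angleCalc_const c hV, angleCalc_sum]
  congr 1
  refine Finset.sum_congr rfl fun i _ => ?_
  rw [angleCalc_const_mul, angleCalc_cos hV]

theorem angleCalc_hPoly_eq (hV : V ∈ Matrix.unitaryGroup (Fin d) ℂ) :
    angleCalc hPoly V = ((403 / 2000 : ℝ) : ℂ) • 1 +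
      ∑ i : Fin 5, (cosCoeff i : ℂ) • cosMat (i + 1 : ℕ) V :=
  angleCalc_const_add_sum_cos hV _ _

theorem angleCalc_gPoly_eq (hV : V ∈ Matrix.unitaryGroup (Fin d) ℂ) :
    angleCalc gPoly V = ((403 / 2000 : ℝ) : ℂ) • 1 +
      ∑ i : Fin 5, (((-1) ^ ((i : ℕ) + 1) * cosCoeff i : ℝ) : ℂ) • cosMat (i + 1 : ℕ) V :=
  angleCalc_const_add_sum_cos hV _ _

theorem norm_angleCalc_h_sub_le (V : Matrix (Fin d) (Fin d) ℂ) :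
    ‖angleCalc h V - angleCalc hPoly V‖ ≤ 1 / 250 := by
  rw [← angleCalc_sub]
  exact norm_angleCalc_le abs_h_sub_hPoly_le V

theorem norm_angleCalc_g_sub_le (V : Matrix (Fin d) (Fin d) ℂ) :
    ‖angleCalc g V - angleCalc gPoly V‖ ≤ 1 / 250 := by
  rw [← angleCalc_sub]
  exact norm_angleCalc_le abs_g_sub_gPoly_le V

/-- The commutator estimate that a cosine polynomial near `q` gives for `q[V]`. -/
theorem norm_commutator_le {U Y : Matrix (Fin d) (Fin d) ℂ}
    (hU : U ∈ Matrix.unitaryGroup (Fin d) ℂ) (hV : V ∈ Matrix.unitaryGroup (Fin d) ℂ) (c : ℂ)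
    (a : Fin 5 → ℝ) {e : ℝ}
    (hY : ‖Y - (c • 1 + ∑ i : Fin 5, (a i : ℂ) • cosMat (i + 1 : ℕ) V)‖ ≤ e) :
    ‖Y * U - U * Y‖ ≤ (∑ i : Fin 5, |a i| * (i + 1)) * ‖V * U - U * V‖ + 2 * e := by
  obtain ⟨D, hD⟩ : ∃ D, D = Y - (c • 1 + ∑ i : Fin 5, (a i : ℂ) • cosMat (i + 1 : ℕ) V) :=
    ⟨_, rfl⟩
  rw [← hD] at hY
  have hY' : Y = D + c • 1 + ∑ i : Fin 5, (a i : ℂ) • cosMat (i + 1 : ℕ) V := by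
    rw [hD]; abel
  have e1 : Y * U - U * Y = (∑ i : Fin 5, (a i : ℂ) •
      (cosMat (i + 1 : ℕ) V * U - U * cosMat (i + 1 : ℕ) V)) + (D * U - U * D) := by
    rw [hY']
    simp only [add_mul, mul_add, Finset.sum_mul, Finset.mul_sum, smul_mul_assoc, mul_smul_comm,
      one_mul, mul_one, smul_sub, Finset.sum_sub_distrib]
    abel
  have hU1 := norm_le_one_of_mem_unitaryGroup hU
  have e2 : ‖D * U - U * D‖ ≤ 2 * e := by
    have h1 := norm_mul_le D U
    have h2 := norm_mul_le U D
    have h3 := norm_sub_le (D * U) (U * D)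
    have h4 := mul_le_mul_of_nonneg_left hU1 (norm_nonneg D)
    linarith
  rw [e1, Finset.sum_mul]
  refine (norm_add_le _ _).trans (add_le_add ((norm_sum_le _ _).trans
    (Finset.sum_le_sum fun i _ => ?_)) e2)
  rw [norm_smul, Complex.norm_real, Real.norm_eq_abs, mul_assoc]
  refine mul_le_mul_of_nonneg_left ?_ (abs_nonneg _)
  have := norm_cosMat_mul_sub_mul_cosMat_le (X := U) hV hV (i + 1 : ℕ)
  push_cast at this
  exact this

end Expansion

section Estimates

variable {d : ℕ} {U V : Matrix (Fin d) (Fin d) ℂ}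

theorem norm_commutator_h_le (hU : U ∈ Matrix.unitaryGroup (Fin d) ℂ)
    (hV : V ∈ Matrix.unitaryGroup (Fin d) ℂ) :
    ‖angleCalc h V * U - U * angleCalc h V‖ ≤
      2959 / 2000 * ‖V * U - U * V‖ + 1 / 125 := by
  have := norm_commutator_le hU hV _ _ ((angleCalc_hPoly_eq hV) ▸ norm_angleCalc_h_sub_le V)
  refine this.trans (le_of_eq ?_)
  simp only [Fin.sum_univ_five, cosCoeff_zero, cosCoeff_one, cosCoeff_two, cosCoeff_three,
    cosCoeff_four]
  norm_num [abs_of_pos]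

/-- In `h - g` only the odd harmonics occur, up to a small error. -/
theorem norm_commutator_h_sub_g_le (hU : U ∈ Matrix.unitaryGroup (Fin d) ℂ)
    (hV : V ∈ Matrix.unitaryGroup (Fin d) ℂ) :
    ‖U * (angleCalc h V - angleCalc g V) - (angleCalc h V - angleCalc g V) * U‖ / 2 ≤
      1587 / 2000 * ‖V * U - U * V‖ + 1 / 125 := by
  have e1 : (angleCalc h V - angleCalc g V) - ((0 : ℂ) • 1 + ∑ i : Fin 5,
      ((cosCoeff i - (-1) ^ ((i : ℕ) + 1) * cosCoeff i : ℝ) : ℂ) • cosMat (i + 1 : ℕ) V) =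
      (angleCalc h V - angleCalc hPoly V) - (angleCalc g V - angleCalc gPoly V) := by
    rw [angleCalc_hPoly_eq hV, angleCalc_gPoly_eq hV, zero_smul]
    simp only [Complex.ofReal_sub, sub_smul, Finset.sum_sub_distrib]
    abel
  have e2 : ‖(angleCalc h V - angleCalc g V) - ((0 : ℂ) • 1 + ∑ i : Fin 5,
      ((cosCoeff i - (-1) ^ ((i : ℕ) + 1) * cosCoeff i : ℝ) : ℂ) • cosMat (i + 1 : ℕ) V)‖ ≤
      1 / 125 := by
    rw [e1]
    have h1 := norm_sub_le (angleCalc h V - angleCalc hPoly V)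
      (angleCalc g V - angleCalc gPoly V)
    have h2 := norm_angleCalc_h_sub_le V
    have h3 := norm_angleCalc_g_sub_le V
    linarith
  have e3 := norm_commutator_le hU hV _ _ e2
  have e4 : ∑ i : Fin 5, |cosCoeff i - (-1) ^ ((i : ℕ) + 1) * cosCoeff i| * ((i : ℕ) + 1 : ℝ) =
      1587 / 1000 := by
    simp only [Fin.sum_univ_five, cosCoeff_zero, cosCoeff_one, cosCoeff_two, cosCoeff_three,
      cosCoeff_four]
    norm_num [abs_of_pos]
  rw [e4] at e3
  rw [norm_sub_rev]
  linarith

/-- Weights for the harmonics in `norm_f_mul_mul_h_sub_le`, near the optimal ones. -/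
noncomputable def gapWeight : Fin 5 → ℝ := ![107 / 100, 21 / 100, 56 / 100, 8 / 100, 11 / 100]

theorem gapWeight_zero : gapWeight 0 = 107 / 100 := rfl

theorem gapWeight_one : gapWeight 1 = 21 / 100 := rfl

theorem gapWeight_two : gapWeight 2 = 56 / 100 := rfl

theorem gapWeight_three : gapWeight 3 = 8 / 100 := rfl

theorem gapWeight_four : gapWeight 4 = 11 / 100 := rfl

theorem gapWeight_pos (i : Fin 5) : 0 < gapWeight i := by
  fin_cases i <;> norm_num [gapWeight]

/-- Both commutators `[f[V], U]` and `[h[V], U]` enter at once: they form a row, which is multiplied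
by the column `(h[V], -f[V])` of norm at most one. -/
theorem norm_f_mul_mul_h_sub_le (hU : U ∈ Matrix.unitaryGroup (Fin d) ℂ)
    (hV : V ∈ Matrix.unitaryGroup (Fin d) ℂ) :
    ‖angleCalc f V * U * angleCalc h V - angleCalc h V * U * angleCalc f V‖ ≤
      51 / 25 * ‖V * U - U * V‖ + 1 / 125 := by
  obtain ⟨F, hF⟩ : ∃ F, F = angleCalc f V := ⟨_, rfl⟩
  obtain ⟨H, hH⟩ : ∃ H, H = angleCalc h V := ⟨_, rfl⟩
  obtain ⟨D, hD⟩ : ∃ D, D = angleCalc h V - angleCalc hPoly V := ⟨_, rfl⟩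
  let S : Fin 5 → Matrix (Fin d) (Fin d) ℂ := fun i =>
    sinMat (i + 1 : ℕ) V * U - U * sinMat (i + 1 : ℕ) V
  let C : Fin 5 → Matrix (Fin d) (Fin d) ℂ := fun i =>
    cosMat (i + 1 : ℕ) V * U - U * cosMat (i + 1 : ℕ) V
  have hFH : F * H = H * F := by rw [hF, hH, commute_angleCalc]
  have eF : F * U - U * F = ∑ i : Fin 5, (sinCoeff i : ℂ) • S i := by
    rw [hF, angleCalc_f_eq hV, Finset.sum_mul, Finset.mul_sum, ← Finset.sum_sub_distrib]
    simp only [S, smul_mul_assoc, mul_smul_comm, smul_sub]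
  have eH : H * U - U * H = (∑ i : Fin 5, (cosCoeff i : ℂ) • C i) + (D * U - U * D) := by
    have : H = D + ((403 / 2000 : ℝ) : ℂ) • 1 +
        ∑ i : Fin 5, (cosCoeff i : ℂ) • cosMat (i + 1 : ℕ) V := by
      rw [hD, ← hH, angleCalc_hPoly_eq hV]; abel
    rw [this]
    simp only [C, add_mul, mul_add, Finset.sum_mul, Finset.mul_sum, smul_mul_assoc,
      mul_smul_comm, one_mul, mul_one, smul_sub, Finset.sum_sub_distrib]
    abel
  have e1 : F * U * H - H * U * F =
      (∑ i : Fin 5, (S i * ((sinCoeff i : ℂ) • H) + C i * ((-cosCoeff i : ℂ) • F))) -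
        (D * U - U * D) * F := by
    have e2 : F * U * H - H * U * F = (F * U - U * F) * H - (H * U - U * H) * F := by
      rw [sub_mul, sub_mul, mul_assoc U F H, mul_assoc U H F, hFH]; abel
    rw [e2, eF, eH, add_mul, Finset.sum_mul, Finset.sum_mul, Finset.sum_add_distrib]
    simp only [smul_mul_assoc, mul_smul_comm, neg_smul, mul_neg, Finset.sum_neg_distrib]
    abel
  have hFn : ‖F‖ ≤ 1 := by rw [hF]; exact norm_angleCalc_le abs_f_le_one V
  have e3 : ‖(D * U - U * D) * F‖ ≤ 1 / 125 := by
    have h0 : ‖D‖ ≤ 1 / 250 := by rw [hD]; exact norm_angleCalc_h_sub_le V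
    have hU1 := norm_le_one_of_mem_unitaryGroup hU
    have h1 := norm_mul_le D U
    have h2 := norm_mul_le U D
    have h3 := norm_sub_le (D * U) (U * D)
    have h4 := mul_le_mul_of_nonneg_left hU1 (norm_nonneg D)
    have h5 := norm_mul_le (D * U - U * D) F
    have h6 := mul_le_mul_of_nonneg_left hFn (norm_nonneg (D * U - U * D))
    linarith
  have hcol : ∑ i : Fin 5, ((((i : ℕ) + 1 : ℝ) ^ 2 / gapWeight i : ℝ) : ℂ) •
      (star ((sinCoeff i : ℂ) • H) * ((sinCoeff i : ℂ) • H) +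
        star ((-cosCoeff i : ℂ) • F) * ((-cosCoeff i : ℂ) • F)) =
      angleCalc (fun x =>
        (∑ i : Fin 5, ((i : ℕ) + 1 : ℝ) ^ 2 / gapWeight i * sinCoeff i ^ 2) * (h x * h x) +
        (∑ i : Fin 5, ((i : ℕ) + 1 : ℝ) ^ 2 / gapWeight i * cosCoeff i ^ 2) * (f x * f x)) V := by
    rw [angleCalc_add, angleCalc_const_mul, angleCalc_const_mul, angleCalc_mul, angleCalc_mul,
      ← hF, ← hH, Complex.ofReal_sum, Complex.ofReal_sum, Finset.sum_smul, Finset.sum_smul,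
      ← Finset.sum_add_distrib]
    refine Finset.sum_congr rfl fun i _ => ?_
    have hFs : star F = F := by rw [hF, star_angleCalc]
    have hHs : star H = H := by rw [hH, star_angleCalc]
    simp only [star_smul, smul_mul_smul_comm, hFs, hHs, star_neg, Complex.star_def,
      Complex.conj_ofReal, smul_add, smul_smul]
    push_cast
    congr 2 <;> ring
  have hmain : ‖∑ i : Fin 5, (S i * ((sinCoeff i : ℂ) • H) + C i * ((-cosCoeff i : ℂ) • F))‖ ≤
      51 / 25 * ‖V * U - U * V‖ := by
    refine norm_sum_harmonics_le (fun i : Fin 5 => ((i : ℕ) + 1 : ℝ)) gapWeight S C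
      (fun i => (sinCoeff i : ℂ) • H) (fun i => (-cosCoeff i : ℂ) • F) gapWeight_pos
      (fun i => by positivity) (norm_nonneg _) (by norm_num) (fun i => ?_) ?_ ?_
    · have := norm_sin_row_add_cos_row_le (X := U) hV hV (i + 1 : ℕ)
      push_cast at this
      exact this
    · simp only [Fin.sum_univ_five, gapWeight_zero, gapWeight_one, gapWeight_two, gapWeight_three,
        gapWeight_four]
      norm_num
    · rw [hcol]
      refine norm_angleCalc_le (fun x => ?_) V
      have h1 := f_sq_add_g_sq_add_h_sq x
      simp only [Fin.sum_univ_five, gapWeight_zero, gapWeight_one, gapWeight_two, gapWeight_three,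
        gapWeight_four, cosCoeff_zero, cosCoeff_one, cosCoeff_two, cosCoeff_three,
        cosCoeff_four, sinCoeff_zero, sinCoeff_one, sinCoeff_two, sinCoeff_three,
        sinCoeff_four]
      rw [abs_of_nonneg (add_nonneg (mul_nonneg (by norm_num) (mul_self_nonneg _))
        (mul_nonneg (by norm_num) (mul_self_nonneg _)))]
      norm_num
      nlinarith [sq_nonneg (f x), sq_nonneg (g x), sq_nonneg (h x)]
  rw [← hF, ← hH, e1]
  exact (norm_sub_le _ _).trans (add_le_add hmain e3)

end Estimates

/-! ### The Lipschitz estimate for the trigonometric part -/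

section Lipschitz

variable {d : ℕ} {U V U' V' : Matrix (Fin d) (Fin d) ℂ}

/-- Weights for the harmonics in `norm_halfMat_trig_le`, near the optimal ones. -/
noncomputable def lipWeight : Fin 5 → ℝ := ![120 / 100, 94 / 100, 65 / 100, 35 / 100, 12 / 100]

theorem lipWeight_zero : lipWeight 0 = 120 / 100 := rfl

theorem lipWeight_one : lipWeight 1 = 94 / 100 := rfl

theorem lipWeight_two : lipWeight 2 = 65 / 100 := rfl

theorem lipWeight_three : lipWeight 3 = 35 / 100 := rfl

theorem lipWeight_four : lipWeight 4 = 12 / 100 := rfl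

theorem lipWeight_pos (i : Fin 5) : 0 < lipWeight i := by
  fin_cases i <;> norm_num [lipWeight]

/-- The matrix `diag(A, A)`. -/
def blockDup {m : Type*} [Fintype m] (A : Matrix m m ℂ) : Matrix (m ⊕ m) (m ⊕ m) ℂ :=
  Matrix.fromBlocks A 0 0 A

theorem norm_blockDup_row_le {m : Type*} [Fintype m] [DecidableEq m] {A A' : Matrix m m ℂ} {c : ℝ}
    (h : ‖A * star A + A' * star A'‖ ≤ c) :
    ‖blockDup A * star (blockDup A) + blockDup A' * star (blockDup A')‖ ≤ c := by
  have e : blockDup A * star (blockDup A) + blockDup A' * star (blockDup A') =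
      Matrix.fromBlocks (A * star A + A' * star A') 0 0 (A * star A + A' * star A') := by
    simp [blockDup, Matrix.star_eq_conjTranspose, Matrix.fromBlocks_conjTranspose,
      Matrix.fromBlocks_multiply, Matrix.fromBlocks_add]
  rw [e]
  exact norm_fromBlocks_diagonal_le h h

/-- The Pauli matrix `σ_z`. -/
def sigmaZ (m : Type*) [Fintype m] [DecidableEq m] : Matrix (m ⊕ m) (m ⊕ m) ℂ :=
  Matrix.fromBlocks 1 0 0 (-1)

/-- The matrix `W + s σ_x` with `W = [[0, U], [U*, 0]]`. -/
def shiftMat {m : Type*} [Fintype m] [DecidableEq m] (s : ℂ) (U : Matrix m m ℂ) :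
    Matrix (m ⊕ m) (m ⊕ m) ℂ :=
  Matrix.fromBlocks 0 (s • 1 + U) (s • 1 + star U) 0

theorem star_sigmaZ_mul_self (m : Type*) [Fintype m] [DecidableEq m] :
    star (sigmaZ m) * sigmaZ m = 1 := by
  simp [sigmaZ, Matrix.star_eq_conjTranspose, Matrix.fromBlocks_conjTranspose,
    Matrix.fromBlocks_multiply]

/-- The squares of `W + σ_x` and `W - σ_x` add up to `4`. -/
theorem star_shiftMat_mul_self {m : Type*} [Fintype m] [DecidableEq m] {U : Matrix m m ℂ}
    (hU : U ∈ Matrix.unitaryGroup m ℂ) {s : ℝ} (hs : s * s = 1) :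
    star (shiftMat (s : ℂ) U) * shiftMat (s : ℂ) U =
      (2 : ℂ) • 1 + (s : ℂ) • blockDup (U + star U) := by
  have hs' : (s : ℂ) * s = 1 := by exact_mod_cast hs
  have hU1 := Unitary.star_mul_self_of_mem hU
  have hU2 := Unitary.mul_star_self_of_mem hU
  rw [shiftMat, Matrix.star_eq_conjTranspose, Matrix.fromBlocks_conjTranspose,
    Matrix.fromBlocks_multiply, blockDup, ← Matrix.fromBlocks_one, Matrix.fromBlocks_smul,
    Matrix.fromBlocks_smul, Matrix.fromBlocks_add]
  simp only [← Matrix.star_eq_conjTranspose, star_zero, zero_mul, mul_zero, zero_add, add_zero,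
    star_add, star_smul, star_one, star_star, Complex.star_def, Complex.conj_ofReal, add_mul,
    mul_add, smul_mul_assoc, mul_smul_comm, one_mul, mul_one, smul_smul, hs', hU1, hU2, smul_zero,
    smul_add, two_smul, one_smul]
  congr 1 <;> abel

/-- The Lipschitz estimate in `V` for the trigonometric part of `T`. The sine part comes with
`σ_z`, the even cosines with `W + σ_x` and the odd ones with `W - σ_x`; as the squares of the latter
add up to `4`, the even and the odd harmonics cannot both contribute fully. -/
theorem norm_halfMat_trig_le (hU : U ∈ Matrix.unitaryGroup (Fin d) ℂ)
    (hV : V ∈ Matrix.unitaryGroup (Fin d) ℂ) (hV' : V' ∈ Matrix.unitaryGroup (Fin d) ℂ) :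
    ‖halfMat (angleCalc f V - angleCalc f V') (angleCalc gPoly V - angleCalc gPoly V')
      (angleCalc hPoly V - angleCalc hPoly V') U‖ ≤ 163 / 50 * ‖V - V'‖ := by
  let s : Fin 5 → ℝ := fun i => (-1) ^ ((i : ℕ) + 1)
  let S : Fin 5 → Matrix (Fin d) (Fin d) ℂ := fun i =>
    sinMat (i + 1 : ℕ) V * 1 - 1 * sinMat (i + 1 : ℕ) V'
  let C : Fin 5 → Matrix (Fin d) (Fin d) ℂ := fun i =>
    cosMat (i + 1 : ℕ) V * 1 - 1 * cosMat (i + 1 : ℕ) V'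
  have hs : ∀ i, s i * s i = 1 := fun i => by
    simp only [s]
    rw [← mul_pow]; norm_num
  have eF : angleCalc f V - angleCalc f V' = ∑ i : Fin 5, (sinCoeff i : ℂ) • S i := by
    rw [angleCalc_f_eq hV, angleCalc_f_eq hV', ← Finset.sum_sub_distrib]
    simp only [S, smul_sub, one_mul, mul_one]
  have eH : angleCalc hPoly V - angleCalc hPoly V' = ∑ i : Fin 5, (cosCoeff i : ℂ) • C i := by
    rw [angleCalc_hPoly_eq hV, angleCalc_hPoly_eq hV', add_sub_add_left_eq_sub,
      ← Finset.sum_sub_distrib]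
    simp only [C, smul_sub, one_mul, mul_one]
  have eG : angleCalc gPoly V - angleCalc gPoly V' =
      ∑ i : Fin 5, ((s i * cosCoeff i : ℝ) : ℂ) • C i := by
    rw [angleCalc_gPoly_eq hV, angleCalc_gPoly_eq hV', add_sub_add_left_eq_sub,
      ← Finset.sum_sub_distrib]
    simp only [C, s, smul_sub, one_mul, mul_one]
  have e1 : halfMat (angleCalc f V - angleCalc f V') (angleCalc gPoly V - angleCalc gPoly V')
      (angleCalc hPoly V - angleCalc hPoly V') U =
      ∑ i : Fin 5, (blockDup (S i) * ((sinCoeff i : ℂ) • sigmaZ (Fin d)) +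
        blockDup (C i) * ((cosCoeff i : ℂ) • shiftMat (s i : ℂ) U)) := by
    have e2 : ∀ i : Fin 5, blockDup (S i) * ((sinCoeff i : ℂ) • sigmaZ (Fin d)) +
        blockDup (C i) * ((cosCoeff i : ℂ) • shiftMat (s i : ℂ) U) =
        halfMat ((sinCoeff i : ℂ) • S i) (((s i * cosCoeff i : ℝ) : ℂ) • C i)
          ((cosCoeff i : ℂ) • C i) U := by
      intro i
      rw [blockDup, blockDup, sigmaZ, shiftMat, halfMat, Matrix.fromBlocks_smul,
        Matrix.fromBlocks_smul, Matrix.fromBlocks_multiply, Matrix.fromBlocks_multiply,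
        Matrix.fromBlocks_add]
      push_cast
      congr 1 <;>
      simp only [zero_mul, mul_zero, zero_add, add_zero, smul_zero, neg_zero, smul_add, mul_add,
        mul_smul_comm, smul_mul_assoc, mul_one, smul_smul, mul_neg, smul_neg, mul_comm]
    rw [eF, eG, eH, Finset.sum_congr rfl fun i _ => e2 i]
    simp only [Fin.sum_univ_five, halfMat, Matrix.fromBlocks_add, add_mul]
    congr 1 <;> abel
  have hcol : ∑ i : Fin 5, ((((i : ℕ) + 1 : ℝ) ^ 2 / lipWeight i : ℝ) : ℂ) •
      (star ((sinCoeff i : ℂ) • sigmaZ (Fin d)) * ((sinCoeff i : ℂ) • sigmaZ (Fin d)) +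
        star ((cosCoeff i : ℂ) • shiftMat (s i : ℂ) U) *
          ((cosCoeff i : ℂ) • shiftMat (s i : ℂ) U)) =
      ((∑ i : Fin 5, ((i : ℕ) + 1 : ℝ) ^ 2 / lipWeight i *
        (sinCoeff i ^ 2 + 2 * cosCoeff i ^ 2) : ℝ) : ℂ) • 1 +
      ((∑ i : Fin 5, ((i : ℕ) + 1 : ℝ) ^ 2 / lipWeight i *
        (s i * cosCoeff i ^ 2) : ℝ) : ℂ) • blockDup (U + star U) := by
    rw [Complex.ofReal_sum, Complex.ofReal_sum, Finset.sum_smul, Finset.sum_smul,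
      ← Finset.sum_add_distrib]
    refine Finset.sum_congr rfl fun i _ => ?_
    simp only [star_smul, smul_mul_smul_comm, star_sigmaZ_mul_self,
      star_shiftMat_mul_self hU (hs i), Complex.star_def, Complex.conj_ofReal]
    push_cast
    module
  rw [e1]
  have hη : ‖V * 1 - 1 * V'‖ = ‖V - V'‖ := by rw [mul_one, one_mul]
  refine norm_sum_harmonics_le (fun i : Fin 5 => ((i : ℕ) + 1 : ℝ)) lipWeight
    (fun i => blockDup (S i)) (fun i => blockDup (C i))
    (fun i => (sinCoeff i : ℂ) • sigmaZ (Fin d)) (fun i => (cosCoeff i : ℂ) • shiftMat (s i : ℂ) U)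
    lipWeight_pos (fun i => by positivity) (norm_nonneg _) (by norm_num) (fun i => ?_) ?_ ?_
  · have := norm_sin_row_add_cos_row_le (X := 1) hV hV' (i + 1 : ℕ)
    rw [hη] at this
    push_cast at this
    exact norm_blockDup_row_le this
  · simp only [Fin.sum_univ_five, lipWeight_zero, lipWeight_one, lipWeight_two, lipWeight_three,
      lipWeight_four]
    norm_num
  · rw [hcol]
    have hQ : ‖blockDup (U + star U)‖ ≤ 2 := by
      have h1 : ‖U + star U‖ ≤ 2 := by
        have h2 := norm_add_le U (star U)
        have h3 := norm_le_one_of_mem_unitaryGroup hU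
        rw [norm_star] at h2
        linarith
      exact norm_fromBlocks_diagonal_le h1 h1
    have h1 : ‖(1 : Matrix (Fin d ⊕ Fin d) (Fin d ⊕ Fin d) ℂ)‖ ≤ 1 :=
      norm_le_one_of_mem_unitaryGroup (one_mem _)
    refine (norm_add_le _ _).trans ?_
    rw [norm_smul, norm_smul, Complex.norm_real, Complex.norm_real]
    have ha : ‖∑ i : Fin 5, ((i : ℕ) + 1 : ℝ) ^ 2 / lipWeight i *
        (sinCoeff i ^ 2 + 2 * cosCoeff i ^ 2)‖ ≤ 3.24 := by
      simp only [Fin.sum_univ_five, lipWeight_zero, lipWeight_one, lipWeight_two,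
        lipWeight_three, lipWeight_four, cosCoeff_zero, cosCoeff_one, cosCoeff_two,
        cosCoeff_three, cosCoeff_four, sinCoeff_zero, sinCoeff_one, sinCoeff_two, sinCoeff_three,
        sinCoeff_four]
      norm_num [abs_of_pos]
    have hb : ‖∑ i : Fin 5, ((i : ℕ) + 1 : ℝ) ^ 2 / lipWeight i * (s i * cosCoeff i ^ 2)‖ ≤
        0.01 := by
      simp only [Fin.sum_univ_five, lipWeight_zero, lipWeight_one, lipWeight_two,
        lipWeight_three, lipWeight_four, cosCoeff_zero, cosCoeff_one, cosCoeff_two,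
        cosCoeff_three, cosCoeff_four, s, Real.norm_eq_abs, abs_le]
      norm_num
    calc _ ≤ (3.24 : ℝ) * 1 + 0.01 * 2 :=
          add_le_add (mul_le_mul ha h1 (norm_nonneg _) (by norm_num))
            (mul_le_mul hb hQ (norm_nonneg _) (by norm_num))
      _ ≤ _ := by norm_num

end Lipschitz

/-! ### The two halves of the estimate for `B` -/

section Conclusion

variable {d : ℕ} {U V U' V' : Matrix (Fin d) (Fin d) ℂ}

theorem B_eq (U V : Matrix (Fin d) (Fin d) ℂ) :
    B U V = (1 / 2 : ℂ) • (halfMat (angleCalc f V) (angleCalc g V) (angleCalc h V) U +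
      star (halfMat (angleCalc f V) (angleCalc g V) (angleCalc h V) U)) := by
  rw [star_halfMat (star_angleCalc f V) (star_angleCalc g V) (star_angleCalc h V), halfMat, B,
    Matrix.fromBlocks_add, Matrix.fromBlocks_smul]
  congr 1 <;> module

/-- The matrix `B` depends on `U` and `V` in a Lipschitz way, up to the error of the trigonometric
approximation. -/
theorem norm_B_sub_le (hV : V ∈ Matrix.unitaryGroup (Fin d) ℂ)
    (hU' : U' ∈ Matrix.unitaryGroup (Fin d) ℂ) (hV' : V' ∈ Matrix.unitaryGroup (Fin d) ℂ) :
    ‖B U V - B U' V'‖ ≤ ‖U - U'‖ + 163 / 50 * ‖V - V'‖ + 2 / 125 := by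
  obtain ⟨H, hH⟩ : ∃ H, H = angleCalc h V := ⟨_, rfl⟩
  obtain ⟨DG, hDG⟩ : ∃ DG, DG = (angleCalc g V - angleCalc gPoly V) -
    (angleCalc g V' - angleCalc gPoly V') := ⟨_, rfl⟩
  obtain ⟨DH, hDH⟩ : ∃ DH, DH = (angleCalc h V - angleCalc hPoly V) -
    (angleCalc h V' - angleCalc hPoly V') := ⟨_, rfl⟩
  obtain ⟨T, hT⟩ : ∃ T, T = halfMat (angleCalc f V) (angleCalc g V) (angleCalc h V) U := ⟨_, rfl⟩
  obtain ⟨T', hT'⟩ : ∃ T', T' = halfMat (angleCalc f V') (angleCalc g V') (angleCalc h V') U' :=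
    ⟨_, rfl⟩
  have e1 : T - T' = halfMat (angleCalc f V - angleCalc f V')
        (angleCalc gPoly V - angleCalc gPoly V') (angleCalc hPoly V - angleCalc hPoly V') U' +
      Matrix.fromBlocks 0 (DG + DH * U') (DG + DH * star U') 0 +
      Matrix.fromBlocks 0 (H * (U - U')) (H * star (U - U')) 0 := by
    rw [hT, hT', halfMat, halfMat, halfMat, sub_eq_add_neg, Matrix.fromBlocks_neg,
      Matrix.fromBlocks_add, Matrix.fromBlocks_add, Matrix.fromBlocks_add, hDG, hDH, hH, star_sub]
    congr 1
    · abel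
    · noncomm_ring
    · noncomm_ring
    · abel
  have hHn : ‖H‖ ≤ 1 := by
    rw [hH]
    exact norm_angleCalc_le (fun x => (abs_of_nonneg (h_nonneg x)).trans_le (h_le_one x)) V
  have hG1 : ‖DG‖ ≤ 1 / 125 := by
    rw [hDG]
    have := norm_sub_le (angleCalc g V - angleCalc gPoly V) (angleCalc g V' - angleCalc gPoly V')
    linarith [norm_angleCalc_g_sub_le V, norm_angleCalc_g_sub_le V']
  have hH1 : ‖DH‖ ≤ 1 / 125 := by
    rw [hDH]
    have := norm_sub_le (angleCalc h V - angleCalc hPoly V) (angleCalc h V' - angleCalc hPoly V')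
    linarith [norm_angleCalc_h_sub_le V, norm_angleCalc_h_sub_le V']
  have hDn : ∀ X : Matrix (Fin d) (Fin d) ℂ, ‖X‖ ≤ 1 → ‖DG + DH * X‖ ≤ 2 / 125 := by
    intro X hX
    have h1 := norm_add_le DG (DH * X)
    have h2 := norm_mul_le DH X
    have h3 := mul_le_mul_of_nonneg_left hX (norm_nonneg DH)
    linarith
  have hUn := norm_le_one_of_mem_unitaryGroup hU'
  have hHX : ∀ X : Matrix (Fin d) (Fin d) ℂ, ‖H * X‖ ≤ ‖X‖ := fun X =>
    (norm_mul_le H X).trans (mul_le_of_le_one_left (norm_nonneg X) hHn)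
  -- The three summands of `e1`: trigonometric part, approximation error, and change of `U`.
  have h1 := norm_halfMat_trig_le hU' hV hV'
  have h2 := norm_fromBlocks_antidiagonal_le (hDn U' hUn)
    (hDn (star U') ((norm_star U').trans_le hUn))
  have h3 := norm_fromBlocks_antidiagonal_le (hHX (U - U'))
    ((hHX (star (U - U'))).trans_eq (norm_star _))
  have h4 : ‖T - T'‖ ≤ ‖U - U'‖ + 163 / 50 * ‖V - V'‖ + 2 / 125 := by
    rw [e1]
    refine (norm_add_le _ _).trans ?_
    have := norm_add_le (halfMat (angleCalc f V - angleCalc f V')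
        (angleCalc gPoly V - angleCalc gPoly V') (angleCalc hPoly V - angleCalc hPoly V') U')
      (Matrix.fromBlocks 0 (DG + DH * U') (DG + DH * star U') 0)
    linarith
  have e2 : B U V - B U' V' = (1 / 2 : ℂ) • ((T - T') + star (T - T')) := by
    rw [B_eq, B_eq, ← hT, ← hT', star_sub, ← smul_sub]
    congr 1
    abel
  have h5 := norm_add_le (T - T') (star (T - T'))
  rw [norm_star] at h5
  have h6 : ‖(1 / 2 : ℂ)‖ = 1 / 2 := by norm_num
  rw [e2, norm_smul, h6]
  linarith

/-- For `0 ≤ q ≤ 1`, the matrix `q[V] - q[V]²` is of the form `K* K`. -/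
theorem exists_sqrt_defect {q : ℝ → ℝ} (h0 : ∀ x, 0 ≤ q x) (h1 : ∀ x, q x ≤ 1)
    (V : Matrix (Fin d) (Fin d) ℂ) : ∃ K : Matrix (Fin d) (Fin d) ℂ,
      angleCalc q V = angleCalc q V * angleCalc q V + star K * K := by
  refine ⟨angleCalc (fun x => Real.sqrt (q x - q x * q x)) V, ?_⟩
  rw [star_angleCalc, ← angleCalc_mul, ← angleCalc_mul, ← angleCalc_add]
  congr 1
  funext x
  rw [Real.mul_self_sqrt (by nlinarith [h0 x, h1 x])]
  ring

/-- A lower bound for the square of the spectral gap of `B` in terms of the norm `δ` of the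
commutator of `U` and `V`. -/
noncomputable def gapBound (δ : ℝ) : ℝ :=
  1 - (51 / 25 * δ + 1 / 125) - (1587 / 2000 * δ + 1 / 125) - (2959 / 2000 * δ + 1 / 125) ^ 2 / 4

theorem gapBound_mul_sq_norm_le (hU : U ∈ Matrix.unitaryGroup (Fin d) ℂ)
    (hV : V ∈ Matrix.unitaryGroup (Fin d) ℂ) (v : EuclideanSpace ℂ (Fin d ⊕ Fin d)) :
    gapBound ‖U * V - V * U‖ * ‖v‖ ^ 2 ≤ ‖act (B U V) v‖ ^ 2 := by
  have hGH : angleCalc g V * angleCalc h V = 0 := by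
    rw [← angleCalc_mul, funext g_mul_h]
    simpa using angleCalc_const 0 hV
  have hsum : angleCalc f V * angleCalc f V + angleCalc g V * angleCalc g V +
      angleCalc h V * angleCalc h V = 1 := by
    rw [← angleCalc_mul, ← angleCalc_mul, ← angleCalc_mul, ← angleCalc_add, ← angleCalc_add]
    have e : (fun x => f x * f x + g x * g x + h x * h x) = fun _ => (1 : ℝ) := by
      funext x
      rw [← f_sq_add_g_sq_add_h_sq x]
      ring
    rw [e, angleCalc_const 1 hV]
    simp
  obtain ⟨K, hK⟩ := exists_sqrt_defect g_nonneg g_le_one V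
  obtain ⟨L, hL⟩ := exists_sqrt_defect h_nonneg h_le_one V
  have hstar : ‖V * star U - star U * V‖ = ‖V * U - U * V‖ := by
    refine le_antisymm ?_ ?_
    · have := norm_star_mul_sub_mul_star_le (X := V) hU hU
      rwa [norm_sub_rev, norm_sub_rev (V * U)]
    · have := norm_star_mul_sub_mul_star_le (X := V) (Unitary.star_mem hU) (Unitary.star_mem hU)
      rw [star_star] at this
      rwa [norm_sub_rev, norm_sub_rev (V * star U)]
  have h1 := (norm_mul_mul_add_le (U := U) (star_angleCalc g V) (star_angleCalc h V) hGH hK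
    hL).trans (norm_commutator_h_sub_g_le hU hV)
  have h2 := (norm_mul_mul_add_le (U := star U) (star_angleCalc g V) (star_angleCalc h V) hGH hK
    hL).trans (norm_commutator_h_sub_g_le (Unitary.star_mem hU) hV)
  rw [hstar] at h2
  rw [B_eq, gapBound, norm_sub_rev]
  exact le_sq_norm_act_half_add_star (star_angleCalc f V) (star_angleCalc g V)
    (star_angleCalc h V) (commute_angleCalc f g V) hsum hU (norm_f_mul_mul_h_sub_le hU hV) h1 h2
    (norm_commutator_h_le hU hV) v

/-- The numerical inequality that links the spectral gap, the Lipschitz constant `163 / 50`, of which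
`163 / 250` is a fifth, and half of the approximation error `2 / 125`. -/
theorem sqrt_add_le_sqrt_gapBound {δ : ℝ} (h0 : 0 ≤ δ) (h1 : δ ≤ 0.206007) :
    163 / 250 * Real.sqrt (1 - 5 * δ ^ 2) + 1 / 125 ≤ Real.sqrt (gapBound δ) := by
  have hr0 : 0 ≤ 1 - 5 * δ ^ 2 := by nlinarith
  obtain ⟨r, hr⟩ : ∃ r, r = Real.sqrt (1 - 5 * δ ^ 2) := ⟨_, rfl⟩
  have hr2 : r ^ 2 = 1 - 5 * δ ^ 2 := by rw [hr, Real.sq_sqrt hr0]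
  have hr3 : 0 ≤ r := by rw [hr]; exact Real.sqrt_nonneg _
  have hr1 : r ≤ 1 := by nlinarith
  rw [← hr]
  refine Real.le_sqrt_of_sq_le ?_
  unfold gapBound
  norm_num at h1
  nlinarith [mul_nonneg h0 (sub_nonneg.2 h1)]

end Conclusion

end Bott

theorem mainTheorem6 {d : ℕ} (U V U₁ V₁ : Matrix (Fin d) (Fin d) ℂ)
    (hU : U ∈ Matrix.unitaryGroup (Fin d) ℂ) (hV : V ∈ Matrix.unitaryGroup (Fin d) ℂ)
    (hU₁ : U₁ ∈ Matrix.unitaryGroup (Fin d) ℂ) (hV₁ : V₁ ∈ Matrix.unitaryGroup (Fin d) ℂ)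
    (hδ : ‖U * V - V * U‖ ≤ 0.206007) (hδ₁ : ‖U₁ * V₁ - V₁ * U₁‖ ≤ 0.206007)
    (hκ : Bott.kappa U₁ V₁ ≠ Bott.kappa U V) :
    ‖U - U₁‖ + ‖V - V₁‖ ≥
      1 / 5 * Real.sqrt (1 - 5 * ‖U * V - V * U‖ ^ 2) +
        1 / 5 * Real.sqrt (1 - 5 * ‖U₁ * V₁ - V₁ * U₁‖ ^ 2) := by
  have hsig : Bott.Sig (Bott.isHermitian_B U V) ≠ Bott.Sig (Bott.isHermitian_B U₁ V₁) := by
    intro he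
    apply hκ
    rw [Bott.kappa, Bott.kappa, he]
  have h1 := Bott.sqrt_add_le_sqrt_gapBound (norm_nonneg _) hδ
  have h2 := Bott.sqrt_add_le_sqrt_gapBound (norm_nonneg _) hδ₁
  have hpos1 : 0 < Real.sqrt (Bott.gapBound ‖U * V - V * U‖) := by
    have := Real.sqrt_nonneg (1 - 5 * ‖U * V - V * U‖ ^ 2)
    linarith
  have hpos2 : 0 < Real.sqrt (Bott.gapBound ‖U₁ * V₁ - V₁ * U₁‖) := by
    have := Real.sqrt_nonneg (1 - 5 * ‖U₁ * V₁ - V₁ * U₁‖ ^ 2)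
    linarith
  have h3 := Bott.add_le_norm_sub_of_sig_ne (Bott.isHermitian_B U V) (Bott.isHermitian_B U₁ V₁)
    hpos1 hpos2
    (by
      rw [Real.sq_sqrt (Real.sqrt_pos.1 hpos1).le]
      exact Bott.gapBound_mul_sq_norm_le hU hV)
    (by
      rw [Real.sq_sqrt (Real.sqrt_pos.1 hpos2).le]
      exact Bott.gapBound_mul_sq_norm_le hU₁ hV₁) hsig
  have h4 := Bott.norm_B_sub_le hV hU₁ hV₁ (U := U)
  have h5 := norm_nonneg (U - U₁)
  linarith
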